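/- Let $N,K\ge 1$, $s\ge 0$. For $1\le k\le K$ let $E_k$ be a real Banach space (energy space, e.g. $H^1(\mathbb R^N)$), continuously and densely embedded in $L^2(\mathbb R^N;\mathbb R)$, so that $E_k\subset L^2\subset E_k^*$; put $X=\prod_k E_k$, $Y=\prod_k E_k^*$, and let $\langle\cdot,\cdot\rangle$ be the $L^2$ inner product. Let $\mathbf M=\mathrm{diag}(M_1,\dots,M_K)$, where each $M_k:E_k\to E_k^*$ is a Hermitian, positive definite isomorphism. For $\mathbf L_{00}:X\to Y$ and real $\mu=(\mu_1,\dots,\mu_K)$ consider $$\mathbf L_0\mathbf u\equiv \mathbf L_{00}\mathbf u-\mathrm{diag}(\mu_1,\dots,\mu_K)\mathbf u=0,$$ and let $\mathbf L_1:X\to Y$ be the linearization (Fréchet derivative) of $\mathbf L_0$ at $\mathbf u$ and $\mathbf L_1^\dagger$ its Hermitian adjoint. Let $\mathbf u(\cdot;\mu,c)\in X$ be a $C^1$ family of solutions, with $(\mu,c)$ in an open subset $U$ of $\mathbb R^K\times\mathbb R^s$ (the $\mu_k$ are independent; $c=(c_1,\dots,c_s)$ are the free parameters of the solution). Fix $(\mu,c)\in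 U$, write $\mathbf u=\mathbf u(\cdot;\mu,c)$, $P_k=\langle u_k,u_k\rangle$, and suppose that $\mathbf L_{00}$ is $C^2$ near $\mathbf u$. Assume: (i) the kernel of $\mathbf L_1$ at $\mathbf u$ is spanned by the invariance modes $\partial\mathbf u/\partial c_j$, $1\le j\le s$ (Assumption 1), and the range of $\mathbf L_1$ is closed in $Y$ (zero does not belong to its continuous spectrum); (ii) the solutions $\mathbf u(\cdot;\mu,d)$, $(\mu,d)\in U$, are orthogonal to the kernel of their linearized operator $\mathbf L_1$, component by component: $\langle u_k(\cdot;\mu,d),\psi_k\rangle=0$ for all $k$ and all $\psi\in\ker\mathbf L_1$; (iii) $\det(\partial P_i/\partial\mu_j)\ne0$ at $(\mu,c)$. For $f\in Y$ put $a_k(\mathbf u;f)=\langle u_k,[\mathbf M^{-1}f]_k\rangle/\langle u_k,M_k^{-1}u_k\rangle$. The power-conserving squared-operator method (PCSOM) with time step $\Delta t>0$ is $$u_{k,n+1}=\Big[\frac{P_k}{\langle\hat u_{k,n+1},\hat u_{k,n+1}\rangle}\Big]^{1/2}\hat u_{k,n+1},\qquad \hat{\mathbf u}_{n+1}=\mathbf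 u_n-\mathbf M^{-1}\big\{\mathbf L_1^\dagger\mathbf M^{-1}\mathbf L_0\mathbf u-\mathrm{diag}(\gamma_1,\dots,\gamma_K)\mathbf u\big\}_{\mathbf u=\mathbf u_n,\ \mu_k=\mu_{k,n}}\Delta t,$$ with $\mu_{k,n}=a_k(\mathbf u_n;\mathbf L_{00}\mathbf u_n)$ and $\gamma_k=a_k(\mathbf u;\mathbf L_1^\dagger\mathbf M^{-1}\mathbf L_0\mathbf u)$ evaluated in the same way. At the solution $\mathbf u$ define on $X$ the bounded operators $$\mathcal L_{PCV}\Psi=\mathbf M^{-1}\{\hat{\mathbf L}_V\Psi-\mathrm{diag}(\hat\gamma_1,\dots,\hat\gamma_K)\mathbf u\},\qquad \hat{\mathbf L}_V\Psi=-\mathbf L_1^\dagger\mathbf M^{-1}[\mathbf L_1\Psi-\mathrm{diag}(\beta_1,\dots,\beta_K)\mathbf u],$$ with $\hat\gamma_k=a_k(\mathbf u;\hat{\mathbf L}_V\Psi)$, $\beta_k=a_k(\mathbf u;\mathbf L_1\Psi)$; let $\Lambda_{\min}$ be the minimum of the spectrum of $\mathcal L_{PCV}$ and $\Delta t_{\max}=-2/\Lambda_{\min}$.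 Then: (a) If $\Delta t<\Delta t_{\max}$, the PCSOM converges to the solitary wave with component powers $P_1,\dots,P_K$, up to a small shift of the free parameters $c$, whenever the initial condition is close to $\mathbf u$: for every $\varepsilon>0$ there is $\delta>0$ such that for every $\mathbf u_0\in X$ with $\|\mathbf u_0-\mathbf u\|_X<\delta$ all iterates are well defined and stay within distance $\varepsilon$ of $\mathbf u$, and $\mathbf u_n\to\mathbf u(\cdot;\mu,d)$ in $X$ for some $d$ with $|d-c|<\varepsilon$, $(\mu,d)\in U$, where $\mathbf u(\cdot;\mu,d)$ has the component powers $P_1,\dots,P_K$. (b) If $\Delta t>\Delta t_{\max}$, the PCSOM diverges from $\mathbf u$: there is $\varepsilon>0$ such that arbitrarily close to $\mathbf u$ there are initial conditions whose (well-defined) iterates reach distance at least $\varepsilon$ from $\mathbf u$. -/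

import Mathlib

open Filter Topology

namespace PCSOM

/-- Real square-integrable functions on `ℝ^N`, with the `L²` inner product. -/
abbrev L2 (N : ℕ) : Type :=
  MeasureTheory.Lp ℝ 2 (MeasureTheory.volume : MeasureTheory.Measure (EuclideanSpace ℝ (Fin N)))

/-- A `K`-component wave `u = (u_1, …, u_K)`; the component `u_k` lies in the energy space `E k`,
a Banach space that is continuously embedded in `L²(ℝ^N)`, for example `H¹(ℝ^N)`. -/
abbrev State {K : ℕ} (E : Fin K → Type*) : Type _ := ∀ k, E k

/-- The values of the differential operators, for example elements of `H⁻¹(ℝ^N)^K`. -/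
abbrev CoState {K : ℕ} (E : Fin K → Type*) [∀ k, NormedAddCommGroup (E k)]
    [∀ k, NormedSpace ℝ (E k)] : Type _ := ∀ k, StrongDual ℝ (E k)

noncomputable section

variable {N K : ℕ} {E : Fin K → Type*} [∀ k, NormedAddCommGroup (E k)] [∀ k, NormedSpace ℝ (E k)]

/-- The `L²` inner product `⟨u_k, v_k⟩` of the `k`-th components. -/
def ip (ι : ∀ k, E k →L[ℝ] L2 N) (k : Fin K) (a b : E k) : ℝ :=
  inner ℝ (ι k a) (ι k b)

/-- The power `⟨u_k, u_k⟩` of the `k`-th component. -/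
def power (ι : ∀ k, E k →L[ℝ] L2 N) (u : State E) (k : Fin K) : ℝ := ip ι k (u k) (u k)

/-- The inclusion `E k ⊂ L² ⊂ (E k)*`, `a ↦ ⟨a, ·⟩`. -/
def toDual (ι : ∀ k, E k →L[ℝ] L2 N) (k : Fin K) : E k →L[ℝ] StrongDual ℝ (E k) :=
  (innerSL ℝ).bilinearComp (ι k) (ι k)

/-- `u ↦ diag(μ_1, …, μ_K) u`. -/
def diagOp (ι : ∀ k, E k →L[ℝ] L2 N) (μ : Fin K → ℝ) : State E →L[ℝ] CoState E :=
  ContinuousLinearMap.pi fun k => μ k • (toDual ι k).comp (ContinuousLinearMap.proj k)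

/-- `L₀ u = L₀₀ u - diag(μ_1, …, μ_K) u`. -/
def L0 (ι : ∀ k, E k →L[ℝ] L2 N) (L00 : State E → CoState E) (μ : Fin K → ℝ) (u : State E) :
    CoState E := L00 u - diagOp ι μ u

/-- The linearization `L₁` of `L₀` at `u`. -/
def L1 (ι : ∀ k, E k →L[ℝ] L2 N) (L00 : State E → CoState E) (μ : Fin K → ℝ) (u : State E) :
    State E →L[ℝ] CoState E := fderiv ℝ (L0 ι L00 μ) u

/-- The Hermitian adjoint `A†`: `∑_k [A† w]_k (v_k) = ∑_j [A v]_j (w_j)`. -/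
def adj (A : State E →L[ℝ] CoState E) : State E →L[ℝ] CoState E :=
  ContinuousLinearMap.pi fun k => ∑ j,
    (((ContinuousLinearMap.proj j).comp A).comp
      (ContinuousLinearMap.single ℝ E k)).flip.comp (ContinuousLinearMap.proj j)

/-- `M⁻¹` for `M = diag(M_1, …, M_K)`. -/
def Minv (M : ∀ k, E k ≃L[ℝ] StrongDual ℝ (E k)) : CoState E →L[ℝ] State E :=
  ContinuousLinearMap.pi fun k =>
    ((M k).symm : StrongDual ℝ (E k) →L[ℝ] E k).comp (ContinuousLinearMap.proj k)

/-- The quotient `⟨u_k, [M⁻¹ f]_k⟩ / ⟨u_k, M_k⁻¹ u_k⟩`, as a functional of `f`. -/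
def coeff (ι : ∀ k, E k →L[ℝ] L2 N) (M : ∀ k, E k ≃L[ℝ] StrongDual ℝ (E k)) (u : State E)
    (k : Fin K) : CoState E →L[ℝ] ℝ :=
  (ip ι k (u k) ((M k).symm (toDual ι k (u k))))⁻¹ •
    (toDual ι k (u k)).comp ((ContinuousLinearMap.proj k).comp (Minv M))

/-- `f ↦ diag(a_1, …, a_K) u`, where `a_k = ⟨u_k, [M⁻¹ f]_k⟩ / ⟨u_k, M_k⁻¹ u_k⟩`. -/
def coeffDiag (ι : ∀ k, E k →L[ℝ] L2 N) (M : ∀ k, E k ≃L[ℝ] StrongDual ℝ (E k)) (u : State E) :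
    CoState E →L[ℝ] CoState E :=
  ContinuousLinearMap.pi fun k => (coeff ι M u k).smulRight (toDual ι k (u k))

/-- `L̂_V Ψ = -L₁† M⁻¹ [L₁ Ψ - diag(β_1, …, β_K) u]`,
`β_k = ⟨u_k, [M⁻¹ L₁ Ψ]_k⟩ / ⟨u_k, M_k⁻¹ u_k⟩`. -/
def LhatV (ι : ∀ k, E k →L[ℝ] L2 N) (M : ∀ k, E k ≃L[ℝ] StrongDual ℝ (E k))
    (L00 : State E → CoState E) (μ : Fin K → ℝ) (u : State E) : State E →L[ℝ] CoState E :=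
  -(((adj (L1 ι L00 μ u)).comp (Minv M)).comp
    (L1 ι L00 μ u - (coeffDiag ι M u).comp (L1 ι L00 μ u)))

/-- `𝓛_PCV Ψ = M⁻¹ {L̂_V Ψ - diag(γ̂_1, …, γ̂_K) u}`,
`γ̂_k = ⟨u_k, [M⁻¹ L̂_V Ψ]_k⟩ / ⟨u_k, M_k⁻¹ u_k⟩`. -/
def LPCV (ι : ∀ k, E k →L[ℝ] L2 N) (M : ∀ k, E k ≃L[ℝ] StrongDual ℝ (E k))
    (L00 : State E → CoState E) (μ : Fin K → ℝ) (u : State E) : State E →L[ℝ] State E :=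
  (Minv M).comp (LhatV ι M L00 μ u - (coeffDiag ι M u).comp (LhatV ι M L00 μ u))

/-- `Λ_min`: the least point of the spectrum of `𝓛_PCV`. -/
def LambdaMin (ι : ∀ k, E k →L[ℝ] L2 N) (M : ∀ k, E k ≃L[ℝ] StrongDual ℝ (E k))
    (L00 : State E → CoState E) (μ : Fin K → ℝ) (u : State E) : ℝ :=
  sInf (spectrum ℝ (LPCV ι M L00 μ u))

/-- The propagation constants that the scheme assigns to an iterate `u`:
`μ_k = ⟨u_k, [M⁻¹ L₀₀ u]_k⟩ / ⟨u_k, M_k⁻¹ u_k⟩`. -/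
def muOf (ι : ∀ k, E k →L[ℝ] L2 N) (M : ∀ k, E k ≃L[ℝ] StrongDual ℝ (E k))
    (L00 : State E → CoState E) (u : State E) (k : Fin K) : ℝ := coeff ι M u k (L00 u)

/-- `L₁† M⁻¹ L₀ u` at the iterate `u`, with `μ_k` given by `muOf`. -/
def residual (ι : ∀ k, E k →L[ℝ] L2 N) (M : ∀ k, E k ≃L[ℝ] StrongDual ℝ (E k))
    (L00 : State E → CoState E) (u : State E) : CoState E :=
  adj (L1 ι L00 (muOf ι M L00 u) u) (Minv M (L0 ι L00 (muOf ι M L00 u) u))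

/-- `γ_k = ⟨u_k, [M⁻¹ L₁† M⁻¹ L₀ u]_k⟩ / ⟨u_k, M_k⁻¹ u_k⟩`. -/
def gammaOf (ι : ∀ k, E k →L[ℝ] L2 N) (M : ∀ k, E k ≃L[ℝ] StrongDual ℝ (E k))
    (L00 : State E → CoState E) (u : State E) (k : Fin K) : ℝ :=
  coeff ι M u k (residual ι M L00 u)

/-- `û = u - M⁻¹ {L₁† M⁻¹ L₀ u - diag(γ_1, …, γ_K) u} Δt`. -/
def hatStep (ι : ∀ k, E k →L[ℝ] L2 N) (M : ∀ k, E k ≃L[ℝ] StrongDual ℝ (E k))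
    (L00 : State E → CoState E) (Δt : ℝ) (u : State E) : State E :=
  u - Δt • Minv M (residual ι M L00 u - diagOp ι (gammaOf ι M L00 u) u)

/-- One step of the iteration with prescribed component powers `P_k`:
`u_k ↦ [P_k / ⟨û_k, û_k⟩]^{1/2} û_k`. -/
def step (ι : ∀ k, E k →L[ℝ] L2 N) (M : ∀ k, E k ≃L[ℝ] StrongDual ℝ (E k))
    (L00 : State E → CoState E) (P : Fin K → ℝ) (Δt : ℝ) (u : State E) : State E :=
  fun k => √(P k / power ι (hatStep ι M L00 Δt u) k) • hatStep ι M L00 Δt u k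

/-- All expressions in `step` make sense at `u`: `L₀₀` can be linearized at `u`, and no component
by whose norm one divides vanishes. -/
def StepDefined (ι : ∀ k, E k →L[ℝ] L2 N) (M : ∀ k, E k ≃L[ℝ] StrongDual ℝ (E k))
    (L00 : State E → CoState E) (Δt : ℝ) (u : State E) : Prop :=
  DifferentiableAt ℝ L00 u ∧ ∀ k, u k ≠ 0 ∧ hatStep ι M L00 Δt u k ≠ 0

/-- The `n`-th iterate `u_n` of the scheme started at `u₀`. -/
def iter (ι : ∀ k, E k →L[ℝ] L2 N) (M : ∀ k, E k ≃L[ℝ] StrongDual ℝ (E k))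
    (L00 : State E → CoState E) (P : Fin K → ℝ) (Δt : ℝ) (u₀ : State E) (n : ℕ) : State E :=
  (step ι M L00 P Δt)^[n] u₀

/-- The matrix `D = (∂P_i/∂μ_j)` of the family `φ (μ, c)` of waves, at `(μ, c)`. -/
def powerJacobian (ι : ∀ k, E k →L[ℝ] L2 N) {s : ℕ}
    (φ : (Fin K → ℝ) × (Fin s → ℝ) → State E) (μ : Fin K → ℝ) (c : Fin s → ℝ) :
    Matrix (Fin K) (Fin K) ℝ :=
  Matrix.of fun i j => fderiv ℝ (fun ν => power ι (φ (ν, c)) i) μ (Pi.single j 1)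

/-- The invariance mode `∂u/∂c_j` of the family `φ (μ, c)`. -/
def mode {s : ℕ} (φ : (Fin K → ℝ) × (Fin s → ℝ) → State E) (μ : Fin K → ℝ) (c : Fin s → ℝ)
    (j : Fin s) : State E :=
  fderiv ℝ (fun d => φ (μ, d)) c (Pi.single j 1)

end

end PCSOM

open PCSOM

/-
In the energy inner product `⟨a, b⟩_M = ∑ M_k a_k b_k` the operator `A = M⁻¹ L₁` has the adjoint
`A* = M⁻¹ L₁†`, and `x ↦ x - M⁻¹ diag(a_1, …, a_K) u`, with the coefficients `a_k` of the scheme,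
is the orthogonal projection `Q` onto `{x | ⟨u_k, x_k⟩ = 0 for all k}`. Hence `𝓛_PCV = -Q A* Q A`
and `Λ_min = -‖B‖²` for `B = Q A Q`, and on the range of `Q` the linearized scheme is the
Richardson iteration `1 - Δt B* B`. The nondegeneracy of `∂P_i/∂μ_j` and the closed range of `L₁`
bound `B` below modulo the invariance modes. So for `Δt ‖B‖² < 2` the linearized scheme contracts
modulo these modes; they are tangent to the manifold of fixed points `u(·; μ, d)`, along which the
iterates are tracked. For `Δt ‖B‖² > 2` the powers of the linearized scheme grow like `ρⁿ`, where
`ρ > 1` is its norm, and the quadratic remainder is too small to compensate this.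
-/

namespace PCSOM

section Dynamics

variable {X : Type*} [NormedAddCommGroup X] [NormedSpace ℝ X]

/-- The seminorm `p` is a norm equivalent to the given one, with comparison constants `c`, `C`.
Contraction and growth of a linear map are measured in such norms. -/
structure IsEquivNorm (p : Seminorm ℝ X) (c C : ℝ) : Prop where
  lower_pos : 0 < c
  upper_pos : 0 < C
  lower : ∀ x, c * ‖x‖ ≤ p x
  upper : ∀ x, p x ≤ C * ‖x‖

theorem IsEquivNorm.continuous {p : Seminorm ℝ X} {c C : ℝ} (hp : IsEquivNorm p c C) :
    Continuous p :=
  Seminorm.continuous (r := 1) <| mem_of_superset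
    (Metric.ball_mem_nhds 0 (one_div_pos.2 hp.upper_pos)) fun x hx => by
      rw [mem_ball_zero_iff, lt_div_iff₀' hp.upper_pos] at hx
      exact p.mem_ball_zero.2 ((hp.upper x).trans_lt hx)

theorem exists_equivNorm_comp {H : Type*} [NormedAddCommGroup H] [NormedSpace ℝ H] (e : X ≃L[ℝ] H)
    {p : Seminorm ℝ H} {c C : ℝ} (hp : IsEquivNorm p c C) :
    ∃ c' C', IsEquivNorm (p.comp (e : X →ₗ[ℝ] H)) c' C' := by
  refine ⟨c / (‖(e.symm : H →L[ℝ] X)‖ + 1), C * (‖(e : X →L[ℝ] H)‖ + 1),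
    div_pos hp.lower_pos (by positivity), mul_pos hp.upper_pos (by positivity),
    fun x => ?_, fun x => ?_⟩
  · have hx : ‖x‖ ≤ (‖(e.symm : H →L[ℝ] X)‖ + 1) * ‖e x‖ :=
      calc ‖x‖ = ‖(e.symm : H →L[ℝ] X) (e x)‖ := by simp
        _ ≤ ‖(e.symm : H →L[ℝ] X)‖ * ‖e x‖ := ContinuousLinearMap.le_opNorm _ _
        _ ≤ _ := by gcongr; linarith
    calc c / (‖(e.symm : H →L[ℝ] X)‖ + 1) * ‖x‖
        ≤ c / (‖(e.symm : H →L[ℝ] X)‖ + 1) * ((‖(e.symm : H →L[ℝ] X)‖ + 1) * ‖e x‖) := by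
          have := hp.lower_pos
          gcongr
      _ = c * ‖e x‖ := by field_simp
      _ ≤ p (e x) := hp.lower _
  · have hx : ‖e x‖ ≤ (‖(e : X →L[ℝ] H)‖ + 1) * ‖x‖ :=
      ((e : X →L[ℝ] H).le_opNorm x).trans (by gcongr; linarith)
    calc p (e x) ≤ C * ‖e x‖ := hp.upper _
      _ ≤ C * ((‖(e : X →L[ℝ] H)‖ + 1) * ‖x‖) := mul_le_mul_of_nonneg_left hx hp.upper_pos.le
      _ = C * (‖(e : X →L[ℝ] H)‖ + 1) * ‖x‖ := by ring

theorem sum_geometric_le_inv_one_sub {θ : ℝ} (h0 : 0 ≤ θ) (h1 : θ < 1) (n : ℕ) :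
    ∑ i ∈ Finset.range n, θ ^ i ≤ (1 - θ)⁻¹ := by
  rw [← tsum_geometric_of_lt_one h0 h1]
  exact (summable_geometric_of_lt_one h0 h1).sum_le_tsum _ fun i _ => by positivity

section GapContraction

variable {Z : Type*} [MetricSpace Z] {G : Z → Z} {g : Z → ℝ} {z₀ z : Z} {θ D r : ℝ}

theorem iterate_gap_le_and_mem_ball (hθ0 : 0 ≤ θ) (hθ1 : θ < 1) (hD : 0 ≤ D)
    (hg : ∀ z ∈ Metric.ball z₀ r, g (G z) ≤ θ * g z)
    (hG : ∀ z ∈ Metric.ball z₀ r, dist z (G z) ≤ D * g z)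
    (hz : dist z z₀ + D * g z * (1 - θ)⁻¹ < r) (hgz : 0 ≤ g z) (n : ℕ) :
    g (G^[n] z) ≤ θ ^ n * g z ∧ G^[n] z ∈ Metric.ball z₀ r := by
  induction n using Nat.strong_induction_on with
  | _ n ih =>
    constructor
    · cases n with
      | zero => simp
      | succ n =>
        obtain ⟨hgn, hmem⟩ := ih n n.lt_succ_self
        rw [Function.iterate_succ_apply']
        calc g (G (G^[n] z)) ≤ θ * g (G^[n] z) := hg _ hmem
          _ ≤ θ * (θ ^ n * g z) := by gcongr
          _ = θ ^ (n + 1) * g z := by ring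
    · have hdrift : dist z (G^[n] z) ≤ ∑ i ∈ Finset.range n, D * g z * θ ^ i := by
        refine dist_le_range_sum_of_dist_le (f := fun i => G^[i] z) n fun {i} hi => ?_
        obtain ⟨hgi, hmem⟩ := ih i hi
        calc dist (G^[i] z) (G^[i + 1] z) = dist (G^[i] z) (G (G^[i] z)) := by
              rw [Function.iterate_succ_apply']
          _ ≤ D * g (G^[i] z) := hG _ hmem
          _ ≤ D * (θ ^ i * g z) := by gcongr
          _ = D * g z * θ ^ i := by ring
      rw [← Finset.mul_sum] at hdrift
      have hsum : D * g z * ∑ i ∈ Finset.range n, θ ^ i ≤ D * g z * (1 - θ)⁻¹ := by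
        gcongr
        exact sum_geometric_le_inv_one_sub hθ0 hθ1 n
      rw [Metric.mem_ball, dist_comm]
      linarith [dist_triangle z₀ z (G^[n] z), dist_comm z z₀]

/-- The displacements of the orbit are dominated by a geometric series, so the orbit converges
before it can leave the neighbourhood in which the estimates hold. -/
theorem eventually_iterate_tendsto_of_gap [CompleteSpace Z] (hθ0 : 0 ≤ θ) (hθ1 : θ < 1)
    (hD : 0 ≤ D) (hg0 : ∀ z, 0 ≤ g z) (hglim : Tendsto g (𝓝 z₀) (𝓝 0))
    (hg : ∀ᶠ z in 𝓝 z₀, g (G z) ≤ θ * g z) (hG : ∀ᶠ z in 𝓝 z₀, dist z (G z) ≤ D * g z)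
    {s : Set Z} (hs : s ∈ 𝓝 z₀) :
    ∀ᶠ z in 𝓝 z₀, (∀ n, G^[n] z ∈ s) ∧ Tendsto (fun n => g (G^[n] z)) atTop (𝓝 0) ∧
      ∃ w ∈ s, Tendsto (fun n => G^[n] z) atTop (𝓝 w) := by
  obtain ⟨r, hr, hball⟩ := Metric.nhds_basis_closedBall.eventually_iff.1
    ((hg.and hG).and (Filter.eventually_mem_set.2 hs))
  have hlim : Tendsto (fun z => dist z z₀ + D * g z * (1 - θ)⁻¹) (𝓝 z₀) (𝓝 0) := by
    simpa using (tendsto_id.dist (tendsto_const_nhds (x := z₀))).add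
      ((hglim.const_mul D).mul_const (1 - θ)⁻¹)
  filter_upwards [hlim.eventually_lt_const hr] with z hz
  have horbit := iterate_gap_le_and_mem_ball hθ0 hθ1 hD
    (fun z hz => (hball (Metric.ball_subset_closedBall hz)).1.1)
    (fun z hz => (hball (Metric.ball_subset_closedBall hz)).1.2) hz (hg0 z)
  have hmem : ∀ n, G^[n] z ∈ Metric.closedBall z₀ r := fun n =>
    Metric.ball_subset_closedBall (horbit n).2
  have hcauchy : CauchySeq fun n => G^[n] z := by
    refine cauchySeq_of_le_geometric θ (D * g z) hθ1 fun n => ?_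
    calc dist (G^[n] z) (G^[n + 1] z) = dist (G^[n] z) (G (G^[n] z)) := by
          rw [Function.iterate_succ_apply']
      _ ≤ D * g (G^[n] z) := (hball (hmem n)).1.2
      _ ≤ D * (θ ^ n * g z) := by gcongr; exact (horbit n).1
      _ = D * g z * θ ^ n := by ring
  obtain ⟨w, hw⟩ := cauchySeq_tendsto_of_complete hcauchy
  have hgeom : Tendsto (fun n => θ ^ n * g z) atTop (𝓝 0) := by
    simpa using (tendsto_pow_atTop_nhds_zero_of_lt_one hθ0 hθ1).mul_const (g z)
  exact ⟨fun n => (hball (hmem n)).2,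
    squeeze_zero (fun n => hg0 _) (fun n => (horbit n).1) hgeom, w,
    (hball (Metric.isClosed_closedBall.mem_of_tendsto hw (Eventually.of_forall hmem))).2, hw⟩

end GapContraction

section Tracking

theorem tendsto_fst_sub_comp_snd {Y W : Type*} [TopologicalSpace Y] [AddGroup Y] [ContinuousSub Y]
    [TopologicalSpace W] {σ : W → Y} {w₀ : W} (hσ : ContinuousAt σ w₀) :
    Tendsto (fun z : Y × W => z.1 - σ z.2) (𝓝 (σ w₀, w₀)) (𝓝 0) := by
  have hcont : ContinuousAt (fun z : Y × W => z.1 - σ z.2) (σ w₀, w₀) :=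
    continuousAt_fst.sub (hσ.comp (f := Prod.snd) continuousAt_snd)
  simpa [ContinuousAt] using hcont

variable {V : Type*} [NormedAddCommGroup V] {F : X → X} {σ : V → X} {T : X →L[ℝ] X} {v₀ : V}

theorem isLittleO_sub_of_fixed (hF : HasStrictFDerivAt F T (σ v₀)) (hσ : ContinuousAt σ v₀)
    (hfix : ∀ᶠ v in 𝓝 v₀, F (σ v) = σ v) :
    (fun z : X × V => F z.1 - σ z.2 - T (z.1 - σ z.2)) =o[𝓝 (σ v₀, v₀)]
      fun z => z.1 - σ z.2 := by
  have hlim : Tendsto (fun z : X × V => (z.1, σ z.2)) (𝓝 (σ v₀, v₀)) (𝓝 (σ v₀, σ v₀)) :=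
    (continuousAt_fst.prodMk (hσ.comp (f := Prod.snd) continuousAt_snd)).tendsto
  refine (hF.isLittleO.comp_tendsto hlim).congr' ?_ EventuallyEq.rfl
  filter_upwards [continuousAt_snd.eventually hfix] with z hz
  simp only [Function.comp_apply, hz]

theorem isBigO_sub_of_fixed (hF : HasStrictFDerivAt F T (σ v₀)) (hσ : ContinuousAt σ v₀)
    (hfix : ∀ᶠ v in 𝓝 v₀, F (σ v) = σ v) :
    (fun z : X × V => F z.1 - σ z.2) =O[𝓝 (σ v₀, v₀)] fun z => z.1 - σ z.2 :=
  ((isLittleO_sub_of_fixed hF hσ hfix).isBigO.add (T.isBigO_comp _ _)).congr_left fun z => by abel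

variable [NormedSpace ℝ V] {S : V →L[ℝ] X}

/-- One step of `F` followed by the correction `v ↦ v + R (F x - σ v)` of the base point `σ v` on
the manifold parametrized by `σ`, relative to which the position of `x` is measured. -/
def trackingStep (F : X → X) (σ : V → X) (R : X →L[ℝ] V) (z : X × V) : X × V :=
  (F z.1, z.2 + R (F z.1 - σ z.2))

theorem trackingStep_iterate_fst (F : X → X) (σ : V → X) (R : X →L[ℝ] V) (z : X × V) (n : ℕ) :
    ((trackingStep F σ R)^[n] z).1 = F^[n] z.1 :=
  (Function.Semiconj.iterate_right (f := Prod.fst) (fun _ => rfl) n).eq z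

theorem isLittleO_gap_trackingStep (R : X →L[ℝ] V) (hF : HasStrictFDerivAt F T (σ v₀))
    (hσ : HasStrictFDerivAt σ S v₀) (hfix : ∀ᶠ v in 𝓝 v₀, F (σ v) = σ v) :
    (fun z => (trackingStep F σ R z).1 - σ (trackingStep F σ R z).2 -
        (T (z.1 - σ z.2) - S (R (T (z.1 - σ z.2))))) =o[𝓝 (σ v₀, v₀)] fun z => z.1 - σ z.2 := by
  have hσc := hσ.continuousAt
  have hrem := isLittleO_sub_of_fixed hF hσc hfix
  have hcorr : (fun z : X × V => R (F z.1 - σ z.2)) =O[𝓝 (σ v₀, v₀)] fun z => z.1 - σ z.2 :=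
    (R.isBigO_comp _ _).trans (isBigO_sub_of_fixed hF hσc hfix)
  have hgap := tendsto_fst_sub_comp_snd hσc
  have hlim : Tendsto (fun z : X × V => (z.2 + R (F z.1 - σ z.2), z.2)) (𝓝 (σ v₀, v₀))
      (𝓝 (v₀, v₀)) := by
    have hsnd : Tendsto (Prod.snd : X × V → V) (𝓝 (σ v₀, v₀)) (𝓝 v₀) := continuousAt_snd
    simpa using (hsnd.add (hcorr.trans_tendsto hgap)).prodMk_nhds hsnd
  have hmove : (fun z : X × V => σ (z.2 + R (F z.1 - σ z.2)) - σ z.2 - S (R (F z.1 - σ z.2)))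
      =o[𝓝 (σ v₀, v₀)] fun z => z.1 - σ z.2 := by
    refine ((hσ.isLittleO.comp_tendsto hlim).congr_left fun z => ?_).trans_isBigO
      (hcorr.congr_left fun z => ?_) <;> simp
  refine ((hrem.sub (((S.comp R).isBigO_comp _ _).trans_isLittleO hrem)).sub hmove).congr_left
    fun z => ?_
  simp only [trackingStep, ContinuousLinearMap.comp_apply, map_sub]
  abel

theorem eventually_gap_trackingStep_le {R : X →L[ℝ] V} {p : Seminorm ℝ X} {c C q θ : ℝ}
    (hF : HasStrictFDerivAt F T (σ v₀)) (hσ : HasStrictFDerivAt σ S v₀)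
    (hfix : ∀ᶠ v in 𝓝 v₀, F (σ v) = σ v) (hp : IsEquivNorm p c C)
    (hq : ∀ y, p (T y - S (R (T y))) ≤ q * p y) (hqθ : q < θ) :
    ∀ᶠ z in 𝓝 (σ v₀, v₀), p ((trackingStep F σ R z).1 - σ (trackingStep F σ R z).2) ≤
      θ * p (z.1 - σ z.2) := by
  have hη : 0 < (θ - q) * c / C :=
    div_pos (mul_pos (sub_pos.2 hqθ) hp.lower_pos) hp.upper_pos
  filter_upwards [(isLittleO_gap_trackingStep R hF hσ hfix).bound hη] with z hz
  set y := z.1 - σ z.2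
  set y' := (trackingStep F σ R z).1 - σ (trackingStep F σ R z).2
  have hrem : p (y' - (T y - S (R (T y)))) ≤ (θ - q) * p y :=
    calc p (y' - (T y - S (R (T y)))) ≤ C * ‖y' - (T y - S (R (T y)))‖ := hp.upper _
      _ ≤ C * ((θ - q) * c / C * ‖y‖) := mul_le_mul_of_nonneg_left hz hp.upper_pos.le
      _ = (θ - q) * (c * ‖y‖) := by have := hp.upper_pos.ne'; field_simp
      _ ≤ (θ - q) * p y := mul_le_mul_of_nonneg_left (hp.lower y) (sub_pos.2 hqθ).le
  calc p y' = p (y' - (T y - S (R (T y))) + (T y - S (R (T y)))) := by rw [sub_add_cancel]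
    _ ≤ p (y' - (T y - S (R (T y)))) + p (T y - S (R (T y))) := map_add_le_add p _ _
    _ ≤ (θ - q) * p y + q * p y := add_le_add hrem (hq y)
    _ = θ * p y := by ring

theorem exists_dist_trackingStep_le {R : X →L[ℝ] V} {p : Seminorm ℝ X} {c C : ℝ}
    (hF : HasStrictFDerivAt F T (σ v₀)) (hσ : ContinuousAt σ v₀)
    (hfix : ∀ᶠ v in 𝓝 v₀, F (σ v) = σ v) (hp : IsEquivNorm p c C) :
    ∃ D ≥ 0, ∀ᶠ z in 𝓝 (σ v₀, v₀), dist z (trackingStep F σ R z) ≤ D * p (z.1 - σ z.2) := by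
  have hfst := isBigO_sub_of_fixed hF hσ hfix
  have hmove : (fun z => trackingStep F σ R z - z) =O[𝓝 (σ v₀, v₀)] fun z => z.1 - σ z.2 := by
    refine Asymptotics.IsBigO.prod_left ((hfst.sub (Asymptotics.isBigO_refl _ _)).congr_left
      fun z => ?_) (((R.isBigO_comp _ _).trans hfst).congr_left fun z => ?_) <;>
      simp [trackingStep]
  obtain ⟨D, hD, hbound⟩ := hmove.exists_nonneg
  refine ⟨D / c, div_nonneg hD hp.lower_pos.le, ?_⟩
  filter_upwards [hbound.bound] with z hz
  calc dist z (trackingStep F σ R z) = ‖trackingStep F σ R z - z‖ := by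
        rw [dist_comm, dist_eq_norm]
    _ ≤ D * ‖z.1 - σ z.2‖ := hz
    _ = D / c * (c * ‖z.1 - σ z.2‖) := by have := hp.lower_pos.ne'; field_simp
    _ ≤ D / c * p (z.1 - σ z.2) :=
      mul_le_mul_of_nonneg_left (hp.lower _) (div_nonneg hD hp.lower_pos.le)

/-- A manifold of fixed points is asymptotically stable when the linearization contracts
transversally to it: the orbit is tracked by base points `v_n` on the manifold, and the gap
`x_n - σ v_n` decays geometrically. -/
theorem eventually_iterate_tendsto_fixed_manifold [CompleteSpace X] [CompleteSpace V]
    {R : X →L[ℝ] V} {p : Seminorm ℝ X} {c C q : ℝ}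
    (hF : HasStrictFDerivAt F T (σ v₀)) (hσ : HasStrictFDerivAt σ S v₀)
    (hfix : ∀ᶠ v in 𝓝 v₀, F (σ v) = σ v) (hp : IsEquivNorm p c C)
    (hq : ∀ y, p (T y - S (R (T y))) ≤ q * p y) (hq1 : q < 1)
    {s : Set X} (hs : s ∈ 𝓝 (σ v₀)) {w : Set V} (hw : w ∈ 𝓝 v₀) :
    ∀ᶠ x in 𝓝 (σ v₀), (∀ n, F^[n] x ∈ s) ∧
      ∃ v ∈ w, Tendsto (fun n => F^[n] x) atTop (𝓝 (σ v)) := by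
  obtain ⟨θ, hθ, hθ1⟩ := exists_between (max_lt hq1 one_pos)
  obtain ⟨D, hD, hdist⟩ := exists_dist_trackingStep_le (R := R) hF hσ.continuousAt hfix hp
  have hglim : Tendsto (fun z : X × V => p (z.1 - σ z.2)) (𝓝 (σ v₀, v₀)) (𝓝 0) := by
    simpa [Function.comp_def] using
      (hp.continuous.tendsto 0).comp (tendsto_fst_sub_comp_snd hσ.continuousAt)
  obtain ⟨L, w', hw', hlip⟩ := hσ.exists_lipschitzOnWith
  have hnear := eventually_iterate_tendsto_of_gap ((le_max_right _ _).trans hθ.le) hθ1 hD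
    (fun z => apply_nonneg p _) hglim
    (eventually_gap_trackingStep_le hF hσ hfix hp hq ((le_max_left _ _).trans_lt hθ)) hdist
    (prod_mem_nhds hs (inter_mem hw (interior_mem_nhds.2 hw')))
  filter_upwards [(Continuous.prodMk_left v₀).continuousAt.eventually hnear] with x hx
  obtain ⟨hmem, hgap, ⟨x', v⟩, ⟨-, hvw, hvw'⟩, hlim⟩ := hx
  have hfst : Tendsto (fun n => F^[n] x) atTop (𝓝 x') :=
    (((continuous_fst.tendsto _).comp hlim).congr fun n => trackingStep_iterate_fst F σ R _ n)
  have hσv : ContinuousAt σ v := hlip.continuousOn.continuousAt (mem_interior_iff_mem_nhds.1 hvw')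
  have hx' : p (x' - σ v) = 0 := by
    refine tendsto_nhds_unique ((hp.continuous.tendsto _).comp ?_) hgap
    exact ((continuous_fst.tendsto _).comp hlim).sub
      (hσv.tendsto.comp ((continuous_snd.tendsto _).comp hlim))
  have heq : x' = σ v := by
    have h := hp.lower (x' - σ v)
    rw [hx'] at h
    exact sub_eq_zero.1 (norm_le_zero_iff.1 (nonpos_of_mul_nonpos_right h hp.lower_pos))
  refine ⟨fun n => ?_, v, hvw, heq ▸ hfst⟩
  simpa [trackingStep_iterate_fst] using (hmem n).1

end Tracking

end Dynamics

section QuadraticExpansion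

variable {X Y Z : Type*} [NormedAddCommGroup X] [NormedSpace ℝ X] [NormedAddCommGroup Y]
  [NormedSpace ℝ Y] [NormedAddCommGroup Z] [NormedSpace ℝ Z]

/-- The affine map with linear part `f'` approximates `f` at `x₀` up to a quadratic error. This is
the regularity under which linear growth along the orbits of `f'` forces instability. -/
def HasQuadraticExpansionAt (f : X → Y) (f' : X →L[ℝ] Y) (x₀ : X) : Prop :=
  (fun x => f x - f x₀ - f' (x - x₀)) =O[𝓝 x₀] fun x => ‖x - x₀‖ ^ 2

variable {f : X → Y} {f' : X →L[ℝ] Y} {g : Y → Z} {g' : Y →L[ℝ] Z} {x₀ : X}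

theorem HasQuadraticExpansionAt.congr_of_eventuallyEq {f₁ : X → Y}
    (hf : HasQuadraticExpansionAt f f' x₀) (h : f₁ =ᶠ[𝓝 x₀] f) :
    HasQuadraticExpansionAt f₁ f' x₀ := by
  refine Asymptotics.IsBigO.congr' hf ?_ EventuallyEq.rfl
  filter_upwards [h] with x hx
  rw [hx, h.self_of_nhds]

theorem HasQuadraticExpansionAt.isBigO_sub (hf : HasQuadraticExpansionAt f f' x₀) :
    (fun x => f x - f x₀) =O[𝓝 x₀] fun x => ‖x - x₀‖ := by
  have hsq : (fun x => ‖x - x₀‖ ^ 2) =O[𝓝 x₀] fun x => ‖x - x₀‖ := by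
    refine Asymptotics.IsBigO.of_bound 1 ?_
    filter_upwards [Metric.ball_mem_nhds x₀ one_pos] with x hx
    rw [mem_ball_iff_norm] at hx
    rw [norm_pow, norm_norm, one_mul]
    exact pow_le_of_le_one (norm_nonneg _) hx.le two_ne_zero
  have hlin : (fun x => f' (x - x₀)) =O[𝓝 x₀] fun x => ‖x - x₀‖ := (f'.isBigO_comp _ _).norm_right
  exact ((hf.trans hsq).add hlin).congr_left fun x => sub_add_cancel _ _

theorem HasQuadraticExpansionAt.continuousAt (hf : HasQuadraticExpansionAt f f' x₀) :
    ContinuousAt f x₀ := by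
  have hlim : Tendsto (fun x => ‖x - x₀‖) (𝓝 x₀) (𝓝 0) := by
    simpa using (continuous_id.sub continuous_const).norm.tendsto (f := fun x => ‖x - x₀‖) x₀
  exact tendsto_sub_nhds_zero_iff.1 (hf.isBigO_sub.trans_tendsto hlim)

theorem HasQuadraticExpansionAt.comp (hg : HasQuadraticExpansionAt g g' (f x₀))
    (hf : HasQuadraticExpansionAt f f' x₀) :
    HasQuadraticExpansionAt (g ∘ f) (g'.comp f') x₀ := by
  have houter : (fun x => g (f x) - g (f x₀) - g' (f x - f x₀)) =O[𝓝 x₀]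
      fun x => ‖x - x₀‖ ^ 2 :=
    (Asymptotics.IsBigO.comp_tendsto hg hf.continuousAt).trans (hf.isBigO_sub.norm_left.pow 2)
  refine (houter.add ((g'.isBigO_comp _ _).trans hf)).congr_left fun x => ?_
  simp

theorem hasQuadraticExpansionAt_of_contDiffAt (hf : ContDiffAt ℝ 2 f x₀) :
    HasQuadraticExpansionAt f (fderiv ℝ f x₀) x₀ := by
  have hderiv : (fun x => fderiv ℝ f x - fderiv ℝ f x₀) =O[𝓝 x₀] fun x => x - x₀ :=
    ((hf.fderiv_right (m := 1) (by norm_num)).differentiableAt one_ne_zero).hasFDerivAt.isBigO_sub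
  have hdiff : ∀ᶠ x in 𝓝 x₀, DifferentiableAt ℝ f x :=
    (hf.eventually (by norm_num)).mono fun x hx => hx.differentiableAt two_ne_zero
  obtain ⟨C, hC0, hC⟩ := hderiv.exists_pos
  obtain ⟨r, hr, hball⟩ := Metric.eventually_nhds_iff_ball.1 (hC.bound.and hdiff)
  refine Asymptotics.IsBigO.of_bound C ?_
  filter_upwards [Metric.ball_mem_nhds x₀ hr] with x hx
  have hsub : Metric.closedBall x₀ ‖x - x₀‖ ⊆ Metric.ball x₀ r :=
    Metric.closedBall_subset_ball (by rwa [← dist_eq_norm])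
  have hmean := (convex_closedBall x₀ ‖x - x₀‖).norm_image_sub_le_of_norm_hasFDerivWithin_le'
    (f := f) (f' := fderiv ℝ f) (φ := fderiv ℝ f x₀) (C := C * ‖x - x₀‖) (x := x₀) (y := x)
    (fun y hy => (hball y (hsub hy)).2.hasFDerivAt.hasFDerivWithinAt)
    (fun y hy => (hball y (hsub hy)).1.trans
      (mul_le_mul_of_nonneg_left (mem_closedBall_iff_norm.1 hy) hC0.le))
    (Metric.mem_closedBall_self (norm_nonneg _)) (by simp [dist_eq_norm])
  rwa [norm_pow, norm_norm, sq, ← mul_assoc]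

variable {B : X → Y →L[ℝ] X} {h : X → Y}

theorem hasStrictFDerivAt_sub_smul_clm_apply (hB : ContDiffAt ℝ 1 B x₀) (hh : ContDiffAt ℝ 1 h x₀)
    (h0 : h x₀ = 0) (t : ℝ) :
    HasStrictFDerivAt (fun x => x - t • B x (h x)) (1 - t • (B x₀).comp (fderiv ℝ h x₀)) x₀ := by
  have hprod := ((hB.hasStrictFDerivAt one_ne_zero).clm_apply
    (hh.hasStrictFDerivAt one_ne_zero)).const_smul t
  refine ((hasStrictFDerivAt_id x₀).sub hprod).congr_fderiv ?_
  ext1 x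
  simp [h0]

/-- Since `h x₀ = 0`, the variation of `B` enters only through the product of the two first-order
quantities `B x - B x₀` and `h x`, so `B` need only be `C¹`. -/
theorem hasQuadraticExpansionAt_sub_smul_clm_apply (hB : ContDiffAt ℝ 1 B x₀)
    (hh : ContDiffAt ℝ 2 h x₀) (h0 : h x₀ = 0) (t : ℝ) :
    HasQuadraticExpansionAt (fun x => x - t • B x (h x))
      (1 - t • (B x₀).comp (fderiv ℝ h x₀)) x₀ := by
  have hhexp := hasQuadraticExpansionAt_of_contDiffAt hh
  have hBvar : (fun x => B x - B x₀) =O[𝓝 x₀] fun x => ‖x - x₀‖ :=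
    (hB.differentiableAt one_ne_zero).hasFDerivAt.isBigO_sub.norm_right
  have hcross : (fun x => (B x - B x₀) (h x)) =O[𝓝 x₀] fun x => ‖x - x₀‖ ^ 2 := by
    refine (Asymptotics.IsBigO.of_bound 1 (Eventually.of_forall fun x => ?_)).trans
      ((hBvar.norm_left.mul hhexp.isBigO_sub.norm_left).congr_right fun x => (sq _).symm)
    rw [one_mul, norm_mul, norm_norm, norm_norm, h0, sub_zero]
    exact (B x - B x₀).le_opNorm (h x)
  have hlin : (fun x => B x₀ (h x - h x₀ - fderiv ℝ h x₀ (x - x₀))) =O[𝓝 x₀]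
      fun x => ‖x - x₀‖ ^ 2 := ((B x₀).isBigO_comp _ _).trans hhexp
  refine ((hcross.add hlin).const_smul_left (-t)).congr_left fun x => ?_
  simp only [h0, map_sub, sub_apply, smul_apply,
    ContinuousLinearMap.comp_apply, one_apply_eq_self, map_zero, smul_zero, Pi.smul_apply]
  module

end QuadraticExpansion

section Instability

variable {X : Type*} [NormedAddCommGroup X] [NormedSpace ℝ X] {F : X → X} {T : X →L[ℝ] X} {x₀ : X}
  {p : Seminorm ℝ X} {c C ρ : ℝ}

theorem exists_remainder_le_sq (hF : HasQuadraticExpansionAt F T x₀) (hfix : F x₀ = x₀)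
    (hp : IsEquivNorm p c C) {s : Set X} (hs : s ∈ 𝓝 x₀) :
    ∃ r > 0, ∃ B > 0, ∀ x, p (x - x₀) < r →
      x ∈ s ∧ p (F x - x₀ - T (x - x₀)) ≤ B * p (x - x₀) ^ 2 := by
  obtain ⟨D, hD, hbound⟩ := Asymptotics.IsBigO.exists_pos hF
  obtain ⟨r, hr, hball⟩ := Metric.eventually_nhds_iff_ball.1
    (hbound.bound.and (Filter.eventually_mem_set.2 hs))
  have hc := hp.lower_pos
  refine ⟨c * r, mul_pos hc hr, C * D / c ^ 2,
    div_pos (mul_pos hp.upper_pos hD) (by positivity), fun x hx => ?_⟩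
  have hxr : ‖x - x₀‖ < r := lt_of_mul_lt_mul_left ((hp.lower _).trans_lt hx) hc.le
  obtain ⟨hrem, hxs⟩ := hball x (mem_ball_iff_norm.2 hxr)
  rw [hfix, norm_pow, norm_norm] at hrem
  refine ⟨hxs, ?_⟩
  calc p (F x - x₀ - T (x - x₀)) ≤ C * ‖F x - x₀ - T (x - x₀)‖ := hp.upper _
    _ ≤ C * (D * ‖x - x₀‖ ^ 2) := mul_le_mul_of_nonneg_left hrem hp.upper_pos.le
    _ = C * D / c ^ 2 * (c * ‖x - x₀‖) ^ 2 := by field_simp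
    _ ≤ C * D / c ^ 2 * p (x - x₀) ^ 2 := by
      have := hp.upper_pos
      gcongr
      exact hp.lower _

theorem map_pow_apply_le (hρ : 0 ≤ ρ) (hT : ∀ x, p (T x) ≤ ρ * p x) (n : ℕ) (x : X) :
    p ((T ^ n) x) ≤ ρ ^ n * p x := by
  induction n with
  | zero => simp
  | succ n ih =>
    calc p ((T ^ (n + 1)) x) = p (T ((T ^ n) x)) := by rw [pow_succ']; rfl
      _ ≤ ρ * p ((T ^ n) x) := hT _
      _ ≤ ρ * (ρ ^ n * p x) := by gcongr
      _ = ρ ^ (n + 1) * p x := by ring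

theorem apply_le_two_mul_of_sub_smul_pow_le {a σ : ℝ} {h y : X} {n : ℕ} (hρ : 0 ≤ ρ)
    (hT : ∀ x, p (T x) ≤ ρ * p x) (hσ : 0 ≤ σ) (hh : p h ≤ 1) (ha : a * (σ * ρ ^ n) ≤ 1)
    (hy : p (y - σ • (T ^ n) h) ≤ a * (σ * ρ ^ n) ^ 2) : p y ≤ 2 * (σ * ρ ^ n) := by
  have hlin : p (σ • (T ^ n) h) ≤ σ * ρ ^ n := by
    rw [map_smul_eq_mul, Real.norm_of_nonneg hσ]
    gcongr
    exact (map_pow_apply_le hρ hT n h).trans (mul_le_of_le_one_right (by positivity) hh)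
  have hquad : a * (σ * ρ ^ n) ^ 2 ≤ σ * ρ ^ n := by
    rw [sq, ← mul_assoc]
    exact mul_le_of_le_one_left (by positivity) ha
  have htri := map_add_le_add p (y - σ • (T ^ n) h) (σ • (T ^ n) h)
  rw [sub_add_cancel] at htri
  linarith

/-- As long as the amplitude `σ ρ ^ j` of the linearized orbit stays below a fixed threshold, the
nonlinear orbit differs from it by a quantity quadratic in this amplitude. -/
theorem iterate_sub_pow_le_sq {r B a σ : ℝ} {h : X} (hρ : 1 < ρ) (hT : ∀ x, p (T x) ≤ ρ * p x)
    (hB : 0 ≤ B) (hrem : ∀ x, p (x - x₀) < r → p (F x - x₀ - T (x - x₀)) ≤ B * p (x - x₀) ^ 2)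
    (ha0 : 0 ≤ a) (ha : 4 * B ≤ a * (ρ ^ 2 - ρ)) (hσ : 0 ≤ σ) (hh : p h ≤ 1) {n : ℕ}
    (hr : 2 * (σ * ρ ^ n) < r) (ha1 : a * (σ * ρ ^ n) ≤ 1) {j : ℕ} (hj : j ≤ n) :
    p (F^[j] (x₀ + σ • h) - x₀ - σ • (T ^ j) h) ≤ a * (σ * ρ ^ j) ^ 2 ∧
      p (F^[j] (x₀ + σ • h) - x₀) < r := by
  have hamp : ∀ i ≤ n, σ * ρ ^ i ≤ σ * ρ ^ n := fun i hi => by gcongr; exact hρ.le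
  have hsmall : ∀ i ≤ n, p (F^[i] (x₀ + σ • h) - x₀ - σ • (T ^ i) h) ≤ a * (σ * ρ ^ i) ^ 2 →
      p (F^[i] (x₀ + σ • h) - x₀) ≤ 2 * (σ * ρ ^ i) := fun i hi =>
    apply_le_two_mul_of_sub_smul_pow_le (by linarith) hT hσ hh
      ((mul_le_mul_of_nonneg_left (hamp i hi) ha0).trans ha1)
  have herr : ∀ j ≤ n, p (F^[j] (x₀ + σ • h) - x₀ - σ • (T ^ j) h) ≤ a * (σ * ρ ^ j) ^ 2 := by
    intro j hj
    induction j with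
    | zero => simp [mul_nonneg ha0 (sq_nonneg σ)]
    | succ j ih =>
      have hjn : j ≤ n := j.le_succ.trans hj
      set x := F^[j] (x₀ + σ • h)
      have hx : p (x - x₀) ≤ 2 * (σ * ρ ^ j) := hsmall j hjn (ih hjn)
      have hxr : p (x - x₀) < r := by linarith [hamp j hjn]
      have hstep : F^[j + 1] (x₀ + σ • h) - x₀ - σ • (T ^ (j + 1)) h =
          (F x - x₀ - T (x - x₀)) + T (x - x₀ - σ • (T ^ j) h) := by
        rw [Function.iterate_succ_apply', pow_succ', mul_apply_eq_comp, map_sub T (x - x₀),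
          map_smul]
        abel
      calc p (F^[j + 1] (x₀ + σ • h) - x₀ - σ • (T ^ (j + 1)) h)
          ≤ p (F x - x₀ - T (x - x₀)) + p (T (x - x₀ - σ • (T ^ j) h)) := by
            rw [hstep]
            exact map_add_le_add p _ _
        _ ≤ B * (2 * (σ * ρ ^ j)) ^ 2 + ρ * (a * (σ * ρ ^ j) ^ 2) := by
            gcongr
            · exact (hrem x hxr).trans (by gcongr)
            · exact (hT _).trans (by gcongr; exact ih hjn)
        _ = (4 * B + ρ * a) * (σ * ρ ^ j) ^ 2 := by ring
        _ ≤ (a * ρ ^ 2) * (σ * ρ ^ j) ^ 2 := by gcongr; linarith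
        _ = a * (σ * ρ ^ (j + 1)) ^ 2 := by ring
  exact ⟨herr j hj, by linarith [hsmall j hj (herr j hj), hamp j hj]⟩

/-- Instability from linear growth alone: no eigenvector is needed, only vectors `h` (depending on
`n`) which `T ^ n` stretches by the maximal factor `ρ ^ n`, up to a constant. -/
theorem exists_iterate_far (hF : HasQuadraticExpansionAt F T x₀) (hfix : F x₀ = x₀)
    (hp : IsEquivNorm p c C) (hρ : 1 < ρ) (hT : ∀ x, p (T x) ≤ ρ * p x)
    (hgrow : ∀ n, ∃ h, p h ≤ 1 ∧ ρ ^ n / 2 ≤ p ((T ^ n) h)) {s : Set X} (hs : s ∈ 𝓝 x₀) :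
    ∃ ε > 0, ∀ δ > 0, ∃ x, ‖x - x₀‖ < δ ∧ ∃ n, (∀ m < n, F^[m] x ∈ s) ∧ ε ≤ ‖F^[n] x - x₀‖ := by
  obtain ⟨r, hr, B, hB, hrem⟩ := exists_remainder_le_sq hF hfix hp hs
  have hc := hp.lower_pos
  have hC := hp.upper_pos
  have hρ2 : 0 < ρ ^ 2 - ρ := by nlinarith
  set a := 4 * B / (ρ ^ 2 - ρ)
  have ha0 : 0 < a := by positivity
  set τ := min (1 / (4 * a)) (r / 4)
  have hτ0 : 0 < τ := by positivity
  have hτr : 2 * τ < r := by linarith [min_le_right (1 / (4 * a)) (r / 4)]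
  have hτa : a * τ ≤ 1 / 4 :=
    (mul_le_mul_of_nonneg_left (min_le_left _ _) ha0.le).trans_eq (by field_simp)
  refine ⟨τ / (4 * C), by positivity, fun δ hδ => ?_⟩
  obtain ⟨n, hn⟩ := pow_unbounded_of_one_lt (τ / (c * δ)) hρ
  obtain ⟨h, hh, hgrow⟩ := hgrow n
  have hρn : 0 < ρ ^ n := by positivity
  have hσ : τ / ρ ^ n * ρ ^ n = τ := div_mul_cancel₀ _ hρn.ne'
  have horbit : ∀ j ≤ n, _ := fun j hj => iterate_sub_pow_le_sq (σ := τ / ρ ^ n) (j := j) hρ hT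
    hB.le (fun x hx => (hrem x hx).2) ha0.le (div_mul_cancel₀ _ hρ2.ne').ge (by positivity) hh
    (hσ.symm ▸ hτr) (by rw [hσ]; linarith) hj
  refine ⟨x₀ + (τ / ρ ^ n) • h, ?_, n, fun m hm => (hrem _ (horbit m hm.le).2).1, ?_⟩
  · have hnorm : ‖h‖ ≤ 1 / c := (le_div_iff₀' hc).2 ((hp.lower h).trans hh)
    rw [add_sub_cancel_left, norm_smul, Real.norm_of_nonneg (by positivity)]
    calc τ / ρ ^ n * ‖h‖ ≤ τ / ρ ^ n * (1 / c) := by gcongr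
      _ < δ := by
        rw [div_lt_iff₀ (by positivity)] at hn
        rw [div_mul_div_comm, mul_one, div_lt_iff₀ (by positivity)]
        linarith
  · set y := F^[n] (x₀ + (τ / ρ ^ n) • h) - x₀
    have herr : p (y - (τ / ρ ^ n) • (T ^ n) h) ≤ τ / 4 := by
      refine (horbit n le_rfl).1.trans ?_
      rw [hσ]
      nlinarith
    have hlin : τ / 2 ≤ p ((τ / ρ ^ n) • (T ^ n) h) := by
      rw [map_smul_eq_mul, Real.norm_of_nonneg (by positivity)]
      calc τ / 2 = τ / ρ ^ n * (ρ ^ n / 2) := by field_simp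
        _ ≤ _ := by gcongr
    have hy : τ / 4 ≤ p y := by
      have htri := map_sub_le_add p y (y - (τ / ρ ^ n) • (T ^ n) h)
      rw [sub_sub_cancel] at htri
      linarith
    rw [div_le_iff₀ (by positivity)]
    linarith [hp.upper y]

end Instability

theorem exists_equivNorm_of_map_le {X : Type*} [NormedAddCommGroup X] [NormedSpace ℝ X]
    {G : X →L[ℝ] X} {ρ : ℝ} (hρ : 0 < ρ) (hG : ∀ x, ‖G (G x)‖ ≤ ρ * ‖G x‖) :
    ∃ (p : Seminorm ℝ X) (C : ℝ), IsEquivNorm p 1 C ∧ (∀ x, p (G x) ≤ ρ * p x) ∧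
      ∀ x, ‖G x‖ ≤ ρ * ‖x‖ → p x = ‖x‖ := by
  set p : Seminorm ℝ X := normSeminorm ℝ X ⊔
    (Real.toNNReal ρ⁻¹) • (normSeminorm ℝ X).comp (G : X →ₗ[ℝ] X)
  have hp : ∀ x, p x = max ‖x‖ (ρ⁻¹ * ‖G x‖) := fun x => by
    simp [p, NNReal.smul_def, hρ.le]
  have hpx : ∀ x, ‖G x‖ ≤ ρ * ‖x‖ → p x = ‖x‖ := fun x hx => by
    rw [hp, max_eq_left ((inv_mul_le_iff₀ hρ).2 hx)]
  refine ⟨p, max 1 (ρ⁻¹ * ‖G‖), ⟨one_pos, lt_max_of_lt_left one_pos, fun x => ?_, fun x => ?_⟩,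
    fun x => ?_, hpx⟩
  · rw [one_mul, hp]
    exact le_max_left _ _
  · rw [hp, max_mul_of_nonneg _ _ (norm_nonneg x), one_mul, mul_assoc]
    gcongr
    exact G.le_opNorm x
  · rw [hpx _ (hG x), hp, ← inv_mul_le_iff₀ hρ]
    exact le_max_right _ _

theorem norm_apply_le_sqrt_mul {X Y : Type*} [NormedAddCommGroup X] [NormedAddCommGroup Y]
    {a : ℝ} {x : X} {y : Y} (h : ‖y‖ ^ 2 ≤ a * ‖x‖ ^ 2) : ‖y‖ ≤ √a * ‖x‖ := by
  rw [← Real.sqrt_sq (norm_nonneg y), ← Real.sqrt_sq (norm_nonneg x),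
    ← Real.sqrt_mul' a (sq_nonneg _)]
  exact Real.sqrt_le_sqrt h

section Hilbert

open scoped InnerProduct InnerProductSpace

variable {H : Type*} [NormedAddCommGroup H] [InnerProductSpace ℝ H] [CompleteSpace H]

theorem norm_adjoint_comp_self_apply_sq_le (B : H →L[ℝ] H) (x : H) :
    ‖(B†) (B x)‖ ^ 2 ≤ ‖B‖ ^ 2 * ‖B x‖ ^ 2 := by
  rw [← mul_pow]
  gcongr
  simpa using (B†).le_opNorm (B x)

theorem norm_sub_smul_adjoint_comp_self_apply_sq_le (B : H →L[ℝ] H) (t : ℝ) (x : H) :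
    ‖x - t • (B†) (B x)‖ ^ 2 ≤ ‖x‖ ^ 2 - t * (2 - t * ‖B‖ ^ 2) * ‖B x‖ ^ 2 := by
  have hinner : ⟪x, (B†) (B x)⟫_ℝ = ‖B x‖ ^ 2 := by
    rw [ContinuousLinearMap.adjoint_inner_right, real_inner_self_eq_norm_sq]
  rw [norm_sub_sq_real, real_inner_smul_right, hinner, norm_smul, mul_pow, Real.norm_eq_abs, sq_abs]
  linarith [mul_le_mul_of_nonneg_left (norm_adjoint_comp_self_apply_sq_le B x) (sq_nonneg t)]

theorem norm_sq_mem_spectrum_adjoint_mul_self [Nontrivial H] (B : H →L[ℝ] H) :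
    ‖B‖ ^ 2 ∈ spectrum ℝ (B† * B) := by
  rcases eq_or_ne B 0 with rfl | hB
  · simp
  intro hunit
  have hB0 : 0 < ‖B‖ := norm_pos_iff.2 hB
  set D := algebraMap ℝ (H →L[ℝ] H) (‖B‖ ^ 2) - B† * B
  obtain ⟨W, hW⟩ : ∃ W, W * D = 1 := ⟨_, hunit.unit.inv_mul⟩
  have hW0 : 0 < ‖W‖ := norm_pos_iff.2 (by rintro rfl; simp at hW)
  have hDx : ∀ x, ‖D x‖ ^ 2 ≤ ‖B‖ ^ 2 * (‖B‖ ^ 2 * ‖x‖ ^ 2 - ‖B x‖ ^ 2) := fun x => by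
    have hx : D x = ‖B‖ ^ 2 • (x - (‖B‖ ^ 2)⁻¹ • (B†) (B x)) := by
      rw [smul_sub, smul_inv_smul₀ (by positivity)]
      simp [D, Algebra.algebraMap_eq_smul_one]
    rw [hx, norm_smul, mul_pow, Real.norm_of_nonneg (by positivity)]
    refine (mul_le_mul_of_nonneg_left (norm_sub_smul_adjoint_comp_self_apply_sq_le B _ x)
      (by positivity)).trans_eq ?_
    field_simp
    ring
  have hxD : ∀ x, ‖x‖ ^ 2 ≤ ‖W‖ ^ 2 * ‖D x‖ ^ 2 := fun x => by
    rw [← mul_pow]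
    gcongr
    calc ‖x‖ = ‖W (D x)‖ := by rw [← mul_apply_eq_comp, hW, one_apply_eq_self]
      _ ≤ ‖W‖ * ‖D x‖ := W.le_opNorm _
  set k := 1 / (‖W‖ ^ 2 * ‖B‖ ^ 2)
  have hBx : ∀ x, ‖B x‖ ^ 2 ≤ (‖B‖ ^ 2 - k) * ‖x‖ ^ 2 := fun x => by
    have hk : k * ‖x‖ ^ 2 ≤ ‖B‖ ^ 2 * ‖x‖ ^ 2 - ‖B x‖ ^ 2 := by
      rw [div_mul_eq_mul_div, one_mul, div_le_iff₀' (by positivity), mul_assoc]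
      exact (hxD x).trans (mul_le_mul_of_nonneg_left (hDx x) (by positivity))
    linarith
  have hle : ‖B‖ ≤ √(‖B‖ ^ 2 - k) :=
    B.opNorm_le_bound (Real.sqrt_nonneg _) fun x => norm_apply_le_sqrt_mul (hBx x)
  exact hle.not_gt ((Real.sqrt_lt' hB0).2 (sub_lt_self _ (by positivity)))

theorem pow_norm_le_norm_pow {T : H →L[ℝ] H} (hT : IsSelfAdjoint T) {n : ℕ} (hn : n ≠ 0) :
    ‖T‖ ^ n ≤ ‖T ^ n‖ := by
  rcases eq_or_ne T 0 with rfl | hT0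
  · simp [hn]
  obtain ⟨m, hm⟩ := Nat.exists_eq_add_of_lt n.lt_two_pow_self
  have hm0 : 0 < ‖T‖ ^ (m + 1) := pow_pos (norm_pos_iff.2 hT0) _
  refine le_of_mul_le_mul_right ?_ hm0
  calc ‖T‖ ^ n * ‖T‖ ^ (m + 1) = ‖T ^ 2 ^ n‖ := by
        rw [← pow_add, hT.norm_pow_two_pow, hm, add_assoc]
    _ ≤ ‖T ^ n‖ * ‖T ^ (m + 1)‖ := by
      rw [hm, add_assoc, pow_add]
      exact norm_mul_le _ _
    _ ≤ ‖T ^ n‖ * ‖T‖ ^ (m + 1) := by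
      gcongr
      exact norm_pow_le' T m.succ_pos

variable {A Q T : H →L[ℝ] H} {t : ℝ}

theorem adjoint_compression (hQ : IsStarProjection Q) : (Q * A * Q)† = Q * A† * Q := by
  have hQs : Q† = Q := hQ.isSelfAdjoint
  simp only [← ContinuousLinearMap.star_eq_adjoint] at hQs ⊢
  simp only [star_mul, hQs, mul_assoc]

theorem adjoint_compression_mul_self (hQ : IsStarProjection Q) :
    (Q * A * Q)† * (Q * A * Q) = Q * A† * Q * A * Q := by
  rw [adjoint_compression hQ]
  simp only [mul_assoc]
  rw [← mul_assoc Q Q, hQ.isIdempotentElem.eq]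

theorem isLeast_spectrum_neg_compression (hQ : IsStarProjection Q) (hB : Q * A * Q ≠ 0) :
    IsLeast (spectrum ℝ (-(Q * A† * Q * A))) (-‖Q * A * Q‖ ^ 2) := by
  have : Nontrivial H := by
    by_contra h
    rw [not_nontrivial_iff_subsingleton] at h
    exact hB (Subsingleton.elim _ _)
  have hspec : spectrum ℝ (Q * A† * Q * A) \ {0} =
      spectrum ℝ ((Q * A * Q)† * (Q * A * Q)) \ {0} := by
    have hfactor : Q * A† * Q * A = Q * (Q * A† * Q * A) := by
      simp only [← mul_assoc, hQ.isIdempotentElem.eq]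
    rw [hfactor, spectrum.nonzero_mul_comm, adjoint_compression_mul_self hQ]
  have hB0 : 0 < ‖Q * A * Q‖ ^ 2 := by positivity
  rw [← spectrum.neg_eq]
  refine ⟨?_, fun a ha => ?_⟩
  · rw [Set.mem_neg, neg_neg]
    exact (hspec.symm.subset ⟨norm_sq_mem_spectrum_adjoint_mul_self _, hB0.ne'⟩).1
  rcases eq_or_ne a 0 with rfl | ha0
  · linarith
  have hnorm : ‖-a‖ ≤ ‖Q * A * Q‖ ^ 2 := by
    rw [sq, ← (Q * A * Q).norm_adjoint_comp_self]
    exact spectrum.norm_le_norm_of_mem (hspec.subset ⟨ha, neg_ne_zero.2 ha0⟩).1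
  rw [norm_neg] at hnorm
  linarith [neg_abs_le a, Real.norm_eq_abs a]

end Hilbert

theorem exists_lower_bound_of_isClosed_range {X V : Type*} [NormedAddCommGroup X] [NormedSpace ℝ X]
    [CompleteSpace X] [NormedAddCommGroup V] [NormedSpace ℝ V] [FiniteDimensional ℝ V]
    {A Q : X →L[ℝ] X} (hA : IsClosed (Set.range A)) (hQ : Q * Q = Q)
    (hker : ∀ x, A x = 0 → Q x = x) {m : V →L[ℝ] X} (hQm : ∀ x, Q x = 0 → ∃ a, A (m a) = x)
    (hm : ∀ a, Q (m a) = m a → a = 0) :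
    ∃ C, ∀ w, Q w = w → ∃ g, A g = 0 ∧ ‖w - g‖ ≤ C * ‖Q (A w)‖ := by
  have : CompleteSpace A.range := completeSpace_coe_iff_isComplete.2 hA.isComplete
  obtain ⟨c, -, hc⟩ :=
    A.rangeRestrict.exists_preimage_norm_le A.toLinearMap.surjective_rangeRestrict
  obtain ⟨l, -, hl⟩ := LinearMap.exists_antilipschitzWith
    ((1 - Q).comp m : V →ₗ[ℝ] X) (LinearMap.ker_eq_bot'.2 fun a ha =>
      hm a (sub_eq_zero.1 (by simpa using ha)).symm)
  refine ⟨(1 + ‖m‖ * (l * ‖1 - Q‖)) * c, fun w hw => ?_⟩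
  obtain ⟨a, ha⟩ : ∃ a, A (m a) = A w - Q (A w) :=
    hQm _ (by rw [map_sub, sub_eq_zero]; exact congr($hQ (A w)).symm)
  have hAz : A (w - m a) = Q (A w) := by rw [map_sub, ha, sub_sub_cancel]
  obtain ⟨r, hAr, hr⟩ := hc ⟨Q (A w), w - m a, hAz⟩
  replace hAr : A r = Q (A w) := congrArg Subtype.val hAr
  have hg : A (w - m a - r) = 0 := by rw [map_sub, hAz, hAr, sub_self]
  have hma : (1 - Q) (m a) = -(1 - Q) r := by
    have hQg : w - Q (m a) - Q r = w - m a - r := by simpa only [map_sub, hw] using hker _ hg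
    simp only [sub_apply, one_apply_eq_self]
    linear_combination (norm := module) hQg
  have ha_le : ‖a‖ ≤ l * ‖(1 - Q) r‖ := by
    have := hl.le_mul_norm (map_zero _) a
    rwa [show ((1 - Q).comp m : V →ₗ[ℝ] X) a = -(1 - Q) r from hma, norm_neg] at this
  refine ⟨w - m a - r, hg, ?_⟩
  calc ‖w - (w - m a - r)‖ = ‖r + m a‖ := by congr 1; abel
    _ ≤ ‖r‖ + ‖m‖ * (l * (‖1 - Q‖ * ‖r‖)) := by
      refine (norm_add_le _ _).trans (add_le_add_right ((m.le_opNorm a).trans ?_) _)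
      gcongr
      exact ha_le.trans (by gcongr; exact (1 - Q).le_opNorm r)
    _ = (1 + ‖m‖ * (l * ‖1 - Q‖)) * ‖r‖ := by ring
    _ ≤ (1 + ‖m‖ * (l * ‖1 - Q‖)) * (c * ‖Q (A w)‖) := by gcongr; exact hr
    _ = _ := by ring

section Hilbert

open scoped InnerProduct InnerProductSpace

variable {H : Type*} [NormedAddCommGroup H] [InnerProductSpace ℝ H] [CompleteSpace H]
  {A Q T : H →L[ℝ] H} {t : ℝ}

theorem apply_eq_sub_smul_adjoint_comp_self {B : H →L[ℝ] H} (hTQ : T * Q = Q - t • (B† * B))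
    {x : H} (hx : Q x = x) : T x = x - t • (B†) (B x) := by
  simpa [hx] using congr($hTQ x)

theorem exists_contraction_modulo_ker (hQT : Q * T = T)
    (hTQ : T * Q = Q - t • ((Q * A * Q)† * (Q * A * Q))) (ht : 0 < t)
    (hsmall : t * ‖Q * A * Q‖ ^ 2 < 2) (hker : ∀ x, A x = 0 → Q x = x)
    {C : ℝ} (hC : ∀ w, Q w = w → ∃ g, A g = 0 ∧ ‖w - g‖ ≤ C * ‖Q (A w)‖) :
    ∃ P : H →L[ℝ] H, (∀ x, A (P x) = 0) ∧ ∃ (p : Seminorm ℝ H) (D q : ℝ), IsEquivNorm p 1 D ∧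
      q < 1 ∧ ∀ x, p (T x - P (T x)) ≤ q * p x := by
  have : CompleteSpace A.ker := A.isClosed_ker.completeSpace_coe
  set P := A.ker.starProjection
  have hAP : ∀ x, A (P x) = 0 := A.ker.starProjection_apply_mem
  have hR : IsStarProjection (1 - P) := isStarProjection_starProjection.one_sub
  have hR_norm : ∀ x, ‖(1 - P) x‖ ≤ ‖x‖ := fun x =>
    ((1 - P).le_of_opNorm_le hR.norm_le x).trans_eq (one_mul _)
  set B := Q * A * Q
  set κ := t * (2 - t * ‖B‖ ^ 2) / (max C 1) ^ 2
  have hκ : 0 < κ := div_pos (mul_pos ht (by linarith)) (by positivity)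
  have hT : ∀ y, Q y = y → (1 - P) y = y → ‖T y‖ ^ 2 ≤ (1 - κ) * ‖y‖ ^ 2 := fun y hQy hRy => by
    have hy : ‖y‖ ≤ max C 1 * ‖B y‖ := by
      obtain ⟨g, hg, hyg⟩ := hC y hQy
      have hRg : (1 - P) g = 0 := sub_eq_zero.2 (A.ker.starProjection_eq_self_iff.2 hg).symm
      calc ‖y‖ = ‖(1 - P) (y - g)‖ := by rw [map_sub, hRy, hRg, sub_zero]
        _ ≤ C * ‖Q (A y)‖ := (hR_norm _).trans hyg
        _ ≤ max C 1 * ‖B y‖ := by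
          simp only [B, mul_apply_eq_comp, hQy]
          gcongr
          exact le_max_left _ _
    have hκy : κ * ‖y‖ ^ 2 ≤ t * (2 - t * ‖B‖ ^ 2) * ‖B y‖ ^ 2 := by
      rw [div_mul_eq_mul_div, div_le_iff₀ (by positivity), mul_assoc _ (_ ^ 2), ← mul_pow,
          mul_comm ‖B y‖]
      have : 0 ≤ 2 - t * ‖B‖ ^ 2 := by linarith
      gcongr
    rw [apply_eq_sub_smul_adjoint_comp_self hTQ hQy]
    linarith [norm_sub_smul_adjoint_comp_self_apply_sq_le B t y]
  set q := max √(1 - κ) (1 / 2)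
  have hRT : ∀ x, ‖((1 - P) * T) (((1 - P) * T) x)‖ ≤ q * ‖((1 - P) * T) x‖ := fun x => by
    set y := ((1 - P) * T) x
    have hRy : (1 - P) y = y := congr($hR.isIdempotentElem.eq (T x))
    have hQy : Q y = y := by
      have hy : y = T x - P (T x) := rfl
      rw [hy, map_sub, hker _ (hAP _)]
      exact congr($hQT x - P (T x))
    refine (hR_norm _).trans ((norm_apply_le_sqrt_mul (hT y hQy hRy)).trans ?_)
    gcongr
    exact le_max_left _ _
  obtain ⟨p, D, hp, hpT, -⟩ := exists_equivNorm_of_map_le (lt_max_of_lt_right one_half_pos) hRT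
  refine ⟨P, hAP, p, D, q, hp, max_lt ?_ (by norm_num), hpT⟩
  rw [Real.sqrt_lt' one_pos]
  linarith

theorem exists_growth_of_two_lt (hQ : IsStarProjection Q) (hQT : Q * T = T)
    (hTQ : T * Q = Q - t • ((Q * A * Q)† * (Q * A * Q))) (ht : 0 ≤ t)
    (hlarge : 2 < t * ‖Q * A * Q‖ ^ 2) :
    ∃ (p : Seminorm ℝ H) (D ρ : ℝ), IsEquivNorm p 1 D ∧ 1 < ρ ∧ (∀ x, p (T x) ≤ ρ * p x) ∧
      ∀ n : ℕ, ∃ h, p h ≤ 1 ∧ ρ ^ n / 2 ≤ p ((T ^ n) h) := by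
  set B := Q * A * Q
  have hρ : 1 < ‖T * Q‖ := by
    have hB : t * ‖B‖ ^ 2 = ‖Q - T * Q‖ := by
      rw [hTQ, sub_sub_cancel, norm_smul, Real.norm_of_nonneg ht, sq,
        ← ContinuousLinearMap.norm_adjoint_comp_self]
      rfl
    linarith [norm_sub_le Q (T * Q), hQ.norm_le]
  have hself : IsSelfAdjoint (T * Q) := by
    rw [hTQ]
    exact hQ.isSelfAdjoint.sub (.smul (.all t) (IsSelfAdjoint.star_mul_self B))
  have hconj : ∀ n : ℕ, Q * (T * Q) ^ n = T ^ n * Q :=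
    (show SemiconjBy Q (T * Q) T by rw [SemiconjBy, ← mul_assoc, hQT]).pow_right
  have hTx : ∀ x, Q x = x → ‖T x‖ ≤ ‖T * Q‖ * ‖x‖ := fun x hx => by
    simpa [hx] using (T * Q).le_opNorm x
  obtain ⟨p, D, hp, hpT, hp_eq⟩ := exists_equivNorm_of_map_le (zero_lt_one.trans hρ)
    fun x => hTx (T x) congr($hQT x)
  refine ⟨p, D, _, hp, hρ, hpT, fun n => ?_⟩
  obtain ⟨h, hh, hn⟩ : ∃ h, ‖h‖ < 1 ∧ ‖T * Q‖ ^ (n + 1) / 2 < ‖((T * Q) ^ (n + 1)) h‖ :=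
    ((T * Q) ^ (n + 1)).exists_lt_apply_of_lt_opNorm <|
      (half_lt_self (by positivity)).trans_le (pow_norm_le_norm_pow hself n.succ_ne_zero)
  have hQh : Q (Q h) = Q h := congr($hQ.isIdempotentElem.eq h)
  refine ⟨Q h, ?_, ?_⟩
  · rw [hp_eq _ (hTx _ hQh)]
    exact ((Q.le_of_opNorm_le hQ.norm_le h).trans_eq (one_mul _)).trans hh.le
  have hnorm : ‖((T * Q) ^ (n + 1)) h‖ ≤ ‖T * Q‖ * ‖(T ^ n) (Q h)‖ := by
    have hfactor : (T * Q) ^ (n + 1) = T * Q * (T ^ n * Q) := by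
      rw [← hconj, pow_succ', ← mul_assoc (T * Q), mul_assoc T Q Q, hQ.isIdempotentElem.eq]
    rw [hfactor]
    exact (T * Q).le_opNorm _
  refine le_trans (le_of_mul_le_mul_left ?_ (zero_lt_one.trans hρ))
    ((one_mul ‖_‖).symm.trans_le (hp.lower _))
  calc ‖T * Q‖ * (‖T * Q‖ ^ n / 2) = ‖T * Q‖ ^ (n + 1) / 2 := by ring
    _ ≤ _ := hn.le.trans hnorm

end Hilbert

section Renorming

universe w

variable {X : Type w}

theorem exists_continuousLinearEquiv_of_innerCore [AddCommGroup X] [Module ℝ X]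
    [TopologicalSpace X] [IsTopologicalAddGroup X] [ContinuousConstSMul ℝ X]
    (cd : InnerProductSpace.Core ℝ X) (hcont : ContinuousAt (fun v : X => cd.inner v v) 0)
    (hbdd : Bornology.IsVonNBounded ℝ {v : X | cd.inner v v < 1}) :
    ∃ (H : Type w) (_ : NormedAddCommGroup H) (_ : InnerProductSpace ℝ H) (e : X ≃L[ℝ] H),
      ∀ x y, inner ℝ (e x) (e y) = cd.inner x y := by
  let _ : NormedAddCommGroup X := cd.toNormedAddCommGroupOfTopology hcont hbdd
  let _ : InnerProductSpace ℝ X := .ofCoreOfTopology cd hcont hbdd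
  exact ⟨X, inferInstance, inferInstance, .refl ℝ X, fun _ _ => rfl⟩

variable [NormedAddCommGroup X] [NormedSpace ℝ X]

theorem exists_hilbert_of_isCoercive [CompleteSpace X] {b : X →L[ℝ] X →L[ℝ] ℝ}
    (hb : IsCoercive b) (hsymm : ∀ x y, b x y = b y x) :
    ∃ (H : Type w) (_ : NormedAddCommGroup H) (_ : InnerProductSpace ℝ H) (_ : CompleteSpace H)
      (e : X ≃L[ℝ] H), ∀ x y, inner ℝ (e x) (e y) = b x y := by
  obtain ⟨c, hc, hcb⟩ := hb
  let cd : InnerProductSpace.Core ℝ X :=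
    { inner := fun x y => b x y
      conj_inner_symm := fun x y => hsymm y x
      re_inner_nonneg := fun x => (by positivity : (0 : ℝ) ≤ c * ‖x‖ * ‖x‖).trans (hcb x)
      add_left := fun x y z => by simp
      smul_left := fun x y r => by simp
      definite := fun x (hx : b x x = 0) => by
        have hcx : c * ‖x‖ * ‖x‖ = 0 := le_antisymm ((hcb x).trans_eq hx) (by positivity)
        simpa [hc.ne'] using hcx }
  obtain ⟨H, _, _, e, he⟩ := exists_continuousLinearEquiv_of_innerCore cd
    (show ContinuousAt (fun v : X => b v v) 0 by fun_prop) <| by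
      rw [NormedSpace.isVonNBounded_iff, isBounded_iff_forall_norm_le]
      refine ⟨√(1 / c), fun x (hx : b x x < 1) => Real.le_sqrt_of_sq_le ?_⟩
      rw [le_div_iff₀ hc]
      linarith [hcb x]
  exact ⟨H, _, _, (completeSpace_congr (e := e.toEquiv) e.isUniformEmbedding).1 ‹_›, e, he⟩

end Renorming

section LinearizedStep

open scoped InnerProduct InnerProductSpace

universe w

variable {X : Type w} [NormedAddCommGroup X] [NormedSpace ℝ X]

/-- The linearization `T` of a squared-operator iteration with time step `t`, for an operator `A`
and linear constraints: `b` is an energy inner product, `A'` is the `b`-adjoint of `A`, the range of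
the `b`-orthogonal projection `Q` is the space of constrained perturbations. -/
structure IsLinearizedStep (b : X →L[ℝ] X →L[ℝ] ℝ) (A A' Q T : X →L[ℝ] X) (t : ℝ) : Prop where
  coercive : IsCoercive b
  form_symm : ∀ x y, b x y = b y x
  adjoint : ∀ x y, b (A' x) y = b x (A y)
  proj_proj : Q * Q = Q
  proj_symm : ∀ x y, b (Q x) y = b x (Q y)
  proj_step : Q * T = T
  step_proj : T * Q = Q - t • (Q * A' * Q * A * Q)

variable {b : X →L[ℝ] X →L[ℝ] ℝ} {A A' Q T : X →L[ℝ] X} {t : ℝ}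

theorem adjoint_conj {H : Type*} [NormedAddCommGroup H] [InnerProductSpace ℝ H] [CompleteSpace H]
    {e : X ≃L[ℝ] H} (he : ∀ x y, ⟪e x, e y⟫_ℝ = b x y) (hA' : ∀ x y, b (A' x) y = b x (A y)) :
    (e.conjContinuousAlgEquiv A)† = e.conjContinuousAlgEquiv A' := by
  refine ((ContinuousLinearMap.eq_adjoint_iff _ _).2 fun x y => ?_).symm
  obtain ⟨x, rfl⟩ := e.surjective x
  obtain ⟨y, rfl⟩ := e.surjective y
  simp [he, hA']

namespace IsLinearizedStep

theorem exists_hilbert_model [CompleteSpace X] (h : IsLinearizedStep b A A' Q T t)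
    (hB : Q * A * Q ≠ 0) :
    ∃ (H : Type w) (_ : NormedAddCommGroup H) (_ : InnerProductSpace ℝ H) (_ : CompleteSpace H)
      (e : X ≃L[ℝ] H) (A₁ Q₁ T₁ : H →L[ℝ] H),
      ((∀ x, A₁ (e x) = e (A x)) ∧ (∀ x, Q₁ (e x) = e (Q x)) ∧ ∀ x, T₁ (e x) = e (T x)) ∧
      IsStarProjection Q₁ ∧ Q₁ * T₁ = T₁ ∧
      T₁ * Q₁ = Q₁ - t • ((Q₁ * A₁ * Q₁)† * (Q₁ * A₁ * Q₁)) ∧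
      Q₁ * A₁ * Q₁ ≠ 0 ∧ sInf (spectrum ℝ (-(Q * A' * Q * A))) = -‖Q₁ * A₁ * Q₁‖ ^ 2 := by
  obtain ⟨H, _, _, _, e, he⟩ := exists_hilbert_of_isCoercive h.coercive h.form_symm
  set Φ := e.conjContinuousAlgEquiv
  have hQ : IsStarProjection (Φ Q) :=
    ⟨by rw [IsIdempotentElem, ← map_mul, h.proj_proj], adjoint_conj he h.proj_symm⟩
  have hA : (Φ A)† = Φ A' := adjoint_conj he h.adjoint
  have hΦB : Φ Q * Φ A * Φ Q ≠ 0 := by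
    simpa only [← map_mul] using (map_ne_zero_iff Φ Φ.injective).2 hB
  refine ⟨H, _, _, ‹_›, e, Φ A, Φ Q, Φ T, ⟨fun x => ?_, fun x => ?_, fun x => ?_⟩, hQ, ?_, ?_,
    hΦB, ?_⟩
  · simp [Φ]
  · simp [Φ]
  · simp [Φ]
  · rw [← map_mul, h.proj_step]
  · rw [adjoint_compression_mul_self hQ, hA]
    simpa only [map_mul, map_sub, map_smul] using congrArg Φ h.step_proj
  · rw [← (isLeast_spectrum_neg_compression hQ hΦB).csInf_eq, hA,
      ← AlgEquiv.spectrum_eq Φ (-(Q * A' * Q * A))]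
    simp only [map_mul, map_neg]

theorem exists_contraction [CompleteSpace X] (h : IsLinearizedStep b A A' Q T t)
    (hB : Q * A * Q ≠ 0) (ht : 0 < t) (hsmall : t < -2 / sInf (spectrum ℝ (-(Q * A' * Q * A))))
    (hker : ∀ x, A x = 0 → Q x = x) {C : ℝ}
    (hC : ∀ w, Q w = w → ∃ g, A g = 0 ∧ ‖w - g‖ ≤ C * ‖Q (A w)‖) :
    ∃ P : X →L[ℝ] X, (∀ x, A (P x) = 0) ∧ ∃ (p : Seminorm ℝ X) (c D q : ℝ), IsEquivNorm p c D ∧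
      q < 1 ∧ ∀ x, p (T x - P (T x)) ≤ q * p x := by
  obtain ⟨H, _, _, _, e, A₁, Q₁, T₁, ⟨hA₁, hQ₁, hT₁⟩, -, hQT, hTQ, hB₁, hΛ⟩ :=
    h.exists_hilbert_model hB
  rw [hΛ, neg_div_neg_eq, lt_div_iff₀ (by positivity)] at hsmall
  have hker₁ : ∀ y, A₁ y = 0 → Q₁ y = y := e.surjective.forall.2 fun x hx => by
    rw [hQ₁, hker x (by simpa [hA₁] using hx)]
  have hC₁ : ∀ w, Q₁ w = w → ∃ g, A₁ g = 0 ∧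
      ‖w - g‖ ≤ ‖(e : X →L[ℝ] H)‖ * (|C| * ‖(e.symm : H →L[ℝ] X)‖) * ‖Q₁ (A₁ w)‖ :=
    e.surjective.forall.2 fun x hx => by
      obtain ⟨g, hg, hxg⟩ := hC x (e.injective (by rw [← hQ₁, hx]))
      refine ⟨e g, by rw [hA₁, hg, map_zero], ?_⟩
      rw [hA₁, hQ₁, ← map_sub]
      calc ‖e (x - g)‖ ≤ ‖(e : X →L[ℝ] H)‖ * ‖x - g‖ := (e : X →L[ℝ] H).le_opNorm _
        _ ≤ ‖(e : X →L[ℝ] H)‖ * (|C| * (‖(e.symm : H →L[ℝ] X)‖ * ‖e (Q (A x))‖)) := by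
          gcongr
          refine hxg.trans (mul_le_mul (le_abs_self C) ?_ (norm_nonneg _) (abs_nonneg C))
          simpa using (e.symm : H →L[ℝ] X).le_opNorm (e (Q (A x)))
        _ = _ := by ring
  obtain ⟨P, hAP, p, D, q, hp, hq, hpT⟩ :=
    exists_contraction_modulo_ker hQT hTQ ht hsmall hker₁ hC₁
  obtain ⟨c', D', hpe⟩ := exists_equivNorm_comp e hp
  refine ⟨(e.symm : H →L[ℝ] X) ∘L P ∘L (e : X →L[ℝ] H), fun x => e.injective ?_, _, c', D', q,
    hpe, hq, fun x => ?_⟩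
  · simp [← hA₁, hAP]
  · simpa [hT₁] using hpT (e x)

theorem exists_growth [CompleteSpace X] (h : IsLinearizedStep b A A' Q T t) (hB : Q * A * Q ≠ 0)
    (hlarge : -2 / sInf (spectrum ℝ (-(Q * A' * Q * A))) < t) :
    ∃ (p : Seminorm ℝ X) (c D ρ : ℝ), IsEquivNorm p c D ∧ 1 < ρ ∧ (∀ x, p (T x) ≤ ρ * p x) ∧
      ∀ n : ℕ, ∃ x, p x ≤ 1 ∧ ρ ^ n / 2 ≤ p ((T ^ n) x) := by
  obtain ⟨H, _, _, _, e, A₁, Q₁, T₁, ⟨-, -, hT₁⟩, hQ, hQT, hTQ, hB₁, hΛ⟩ :=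
    h.exists_hilbert_model hB
  rw [hΛ, neg_div_neg_eq] at hlarge
  have ht : 0 ≤ t := (by positivity : 0 ≤ 2 / ‖Q₁ * A₁ * Q₁‖ ^ 2).trans hlarge.le
  rw [div_lt_iff₀ (by positivity)] at hlarge
  obtain ⟨p, D, ρ, hp, hρ, hpT, hgrow⟩ := exists_growth_of_two_lt hQ hQT hTQ ht hlarge
  obtain ⟨c', D', hpe⟩ := exists_equivNorm_comp e hp
  have hpow : ∀ (n : ℕ) x, (T₁ ^ n) (e x) = e ((T ^ n) x) := fun n x => by
    simpa only [FunLike.coe_pow_eq_iterate] using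
      ((show Function.Semiconj e T T₁ from fun x => (hT₁ x).symm).iterate_right n x).symm
  refine ⟨_, c', D', ρ, hpe, hρ, fun x => by simpa [hT₁] using hpT (e x), fun n => ?_⟩
  obtain ⟨y, hy, hyn⟩ := hgrow n
  obtain ⟨x, rfl⟩ := e.surjective y
  exact ⟨x, hy, by simpa [hpow] using hyn⟩

end IsLinearizedStep

theorem compression_ne_zero {X : Type*} [NormedAddCommGroup X] [NormedSpace ℝ X]
    (hX : ¬ FiniteDimensional ℝ X) {A Q : X →L[ℝ] X} (hQ : Q * Q = Q)
    [FiniteDimensional ℝ A.ker] [FiniteDimensional ℝ Q.ker] {C : ℝ}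
    (hC : ∀ w, Q w = w → ∃ g, A g = 0 ∧ ‖w - g‖ ≤ C * ‖Q (A w)‖) : Q * A * Q ≠ 0 := by
  intro h0
  have hQA : ∀ x, A (Q x) = 0 := fun x => by
    obtain ⟨g, hg, hxg⟩ := hC (Q x) congr($hQ x)
    have hQAQ : Q (A (Q x)) = 0 := congr($h0 x)
    rw [hQAQ, norm_zero, mul_zero, norm_le_zero_iff, sub_eq_zero] at hxg
    rw [hxg, hg]
  have hrange : Q.range ≤ A.ker := by
    rintro - ⟨x, rfl⟩
    exact hQA x
  have : FiniteDimensional ℝ Q.range := Submodule.finiteDimensional_of_le hrange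
  have : FiniteDimensional ℝ (X ⧸ Q.ker) :=
    Q.toLinearMap.quotKerEquivRange.symm.finiteDimensional
  exact hX (Module.Finite.of_submodule_quotient Q.ker)

theorem exists_factor_through {X V : Type*} [NormedAddCommGroup X] [NormedSpace ℝ X]
    [NormedAddCommGroup V] [NormedSpace ℝ V] [FiniteDimensional ℝ V] (S : V →L[ℝ] X)
    (P : X →L[ℝ] X) (hP : ∀ x, P x ∈ S.range) : ∃ R : X →L[ℝ] V, ∀ x, S (R x) = P x := by
  obtain ⟨g, hg⟩ := S.toLinearMap.rangeRestrict.exists_rightInverse_of_surjective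
    (LinearMap.range_rangeRestrict _)
  exact ⟨g.toContinuousLinearMap.comp (P.codRestrict _ hP), fun x =>
    congrArg Subtype.val (LinearMap.congr_fun hg (P.codRestrict _ hP x))⟩

end LinearizedStep

section InfiniteDimensional

open MeasureTheory

theorem linearIndependent_indicatorConstLp {α I : Type*} [MeasurableSpace α] {ν : Measure α}
    {S : I → Set α} (hS : ∀ i, MeasurableSet (S i)) (hpos : ∀ i, ν (S i) ≠ 0)
    (hfin : ∀ i, ν (S i) ≠ ⊤) (hdisj : Pairwise fun i j => Disjoint (S i) (S j)) :
    LinearIndependent ℝ fun i => indicatorConstLp 2 (hS i) (hfin i) (1 : ℝ) := by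
  refine linearIndependent_of_ne_zero_of_inner_eq_zero (fun i hi => ?_) fun i j hij => ?_
  · have hnorm : ‖indicatorConstLp 2 (hS i) (hfin i) (1 : ℝ)‖ = ν.real (S i) ^ (1 / (2 : ℝ)) := by
      simp [norm_indicatorConstLp]
    rw [hi, norm_zero, eq_comm, Real.rpow_eq_zero measureReal_nonneg (by norm_num),
      measureReal_eq_zero_iff (hfin i)] at hnorm
    exact hpos i hnorm
  · change inner ℝ _ _ = 0
    rw [L2.real_inner_indicatorConstLp_one_indicatorConstLp_one (hμs := hfin i) (hμt := hfin j),
      (hdisj hij).inter_eq, measureReal_empty]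

theorem not_finiteDimensional_L2 {N : ℕ} (hN : 0 < N) : ¬ FiniteDimensional ℝ (L2 N) := by
  intro hfin
  let x (n : ℕ) : EuclideanSpace ℝ (Fin N) := EuclideanSpace.single ⟨0, hN⟩ (n : ℝ)
  have hdisj : Pairwise fun i j =>
      Disjoint (Metric.ball (x i) (1 / 2)) (Metric.ball (x j) (1 / 2)) :=
    fun i j hij => Metric.ball_disjoint_ball <| by
      have hdist : dist (x i) (x j) = dist i j := by simp [x, Nat.dist_eq, Real.dist_eq]
      rw [hdist, add_halves]
      exact Nat.pairwise_one_le_dist hij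
  exact (linearIndependent_indicatorConstLp (fun _ => measurableSet_ball)
    (fun n => (Metric.measure_ball_pos volume (x n) one_half_pos).ne')
    (fun _ => measure_ball_lt_top.ne) hdisj).finite.not_infinite inferInstance

theorem not_finiteDimensional_state {N K : ℕ} {E : Fin K → Type*} [∀ k, NormedAddCommGroup (E k)]
    [∀ k, NormedSpace ℝ (E k)] (hN : 0 < N) (hK : 0 < K) {ι : ∀ k, E k →L[ℝ] L2 N}
    (hιd : ∀ k, DenseRange (ι k)) : ¬ FiniteDimensional ℝ (State E) := by
  intro hfin
  let k : Fin K := ⟨0, hK⟩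
  have : FiniteDimensional ℝ (E k) :=
    .of_surjective (LinearMap.proj k : State E →ₗ[ℝ] E k) (LinearMap.proj_surjective k)
  have hclosed : IsClosed (Set.range (ι k)) := (ι k).range.closed_of_finiteDimensional
  have hsurj : Function.Surjective (ι k) :=
    Set.range_eq_univ.1 (hclosed.closure_eq ▸ (hιd k).closure_range)
  exact not_finiteDimensional_L2 hN (.of_surjective (ι k).toLinearMap hsurj)

end InfiniteDimensional

theorem isCoercive_of_leftInverse {V : Type*} [NormedAddCommGroup V] [NormedSpace ℝ V]
    {b : V →L[ℝ] V →L[ℝ] ℝ} (hsymm : ∀ x y, b x y = b y x) (hnonneg : ∀ x, 0 ≤ b x x)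
    {g : StrongDual ℝ V →L[ℝ] V} (hg : ∀ x, g (b x) = x) : IsCoercive b := by
  have hcs (x y : V) : b x y ^ 2 ≤ b x x * b y y :=
    b.toBilinForm.apply_sq_le_of_symm hnonneg ⟨hsymm⟩ x y
  have hdual (x : V) : ‖b x‖ ≤ √(b x x * ‖b‖) := by
    refine (b x).opNorm_le_bound (Real.sqrt_nonneg _) fun y => abs_le_of_sq_le_sq ?_ (by positivity)
    calc b x y ^ 2 ≤ b x x * b y y := hcs x y
      _ ≤ b x x * (‖b‖ * ‖y‖ * ‖y‖) :=
        mul_le_mul_of_nonneg_left ((le_abs_self _).trans (b.le_opNorm₂ y y)) (hnonneg x)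
      _ = (√(b x x * ‖b‖) * ‖y‖) ^ 2 := by
        rw [mul_pow, Real.sq_sqrt (mul_nonneg (hnonneg x) (norm_nonneg b))]; ring
  refine ⟨1 / (‖g‖ ^ 2 * ‖b‖ + 1), by positivity, fun x => ?_⟩
  have hx : ‖x‖ ^ 2 ≤ ‖g‖ ^ 2 * (b x x * ‖b‖) := by
    calc ‖x‖ ^ 2 = ‖g (b x)‖ ^ 2 := by rw [hg]
      _ ≤ (‖g‖ * √(b x x * ‖b‖)) ^ 2 := by
        gcongr; exact (g.le_opNorm _).trans (by gcongr; exact hdual x)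
      _ = _ := by rw [mul_pow, Real.sq_sqrt (mul_nonneg (hnonneg x) (norm_nonneg b))]
  rw [mul_assoc, one_div_mul_eq_div, div_le_iff₀ (by positivity)]
  linarith [hnonneg x]

noncomputable section

variable {N K : ℕ} {E : Fin K → Type*} [∀ k, NormedAddCommGroup (E k)] [∀ k, NormedSpace ℝ (E k)]

section EnergyForm

variable {M : ∀ k, E k ≃L[ℝ] StrongDual ℝ (E k)}

variable (M) in
/-- The energy form `∑_k (M_k a_k) (b_k)`, in which the linearized scheme is self-adjoint. -/
def energyForm : State E →L[ℝ] State E →L[ℝ] ℝ :=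
  ∑ k, (M k : E k →L[ℝ] StrongDual ℝ (E k)).bilinearComp (.proj k) (.proj k)

theorem energyForm_apply (a b : State E) : energyForm M a b = ∑ k, M k (a k) (b k) := by
  simp [energyForm]

theorem energyForm_symm (hMsymm : ∀ k a b, M k a b = M k b a) (a b : State E) :
    energyForm M a b = energyForm M b a := by
  simp only [energyForm_apply, hMsymm _ (a _)]

theorem energyForm_Minv (f : CoState E) (b : State E) :
    energyForm M (Minv M f) b = ∑ k, f k (b k) := by
  simp [energyForm_apply, Minv]

theorem isCoercive_energyForm (hMsymm : ∀ k a b, M k a b = M k b a)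
    (hMpos : ∀ k a, a ≠ 0 → 0 < M k a a) : IsCoercive (energyForm M) := by
  have hnonneg (a : State E) : 0 ≤ energyForm M a a := by
    rw [energyForm_apply]
    refine Finset.sum_nonneg fun k _ => ?_
    rcases eq_or_ne (a k) 0 with h | h
    · simp [h]
    · exact (hMpos k _ h).le
  let restrict : StrongDual ℝ (State E) →L[ℝ] CoState E :=
    .pi fun k => (ContinuousLinearMap.compL ℝ _ _ ℝ).flip (.single ℝ E k)
  have hrestrict (a : State E) (k : Fin K) : restrict (energyForm M a) k = M k (a k) := by
    ext x
    simp only [restrict, ContinuousLinearMap.coe_pi', ContinuousLinearMap.flip_apply,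
      ContinuousLinearMap.compL_apply, ContinuousLinearMap.comp_apply,
      ContinuousLinearMap.single_apply, energyForm_apply]
    rw [Finset.sum_eq_single k (fun j _ hj => by simp [hj]) (by simp), Pi.single_eq_same]
  refine isCoercive_of_leftInverse (energyForm_symm hMsymm) hnonneg
    (g := (Minv M).comp restrict) fun a => ?_
  ext1 k
  simp [Minv, hrestrict]

theorem sum_adj_apply (A : State E →L[ℝ] CoState E) (w v : State E) :
    ∑ k, adj A w k (v k) = ∑ j, A v j (w j) := by
  have hcol (j : Fin K) : ∑ k, A (Pi.single k (v k)) j (w j) = A v j (w j) := by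
    conv_rhs => rw [← Finset.univ_sum_single v]
    simp [map_sum, Finset.sum_apply]
  simp only [adj, ContinuousLinearMap.coe_pi', sum_apply, ContinuousLinearMap.comp_apply,
    ContinuousLinearMap.flip_apply, ContinuousLinearMap.proj_apply,
    ContinuousLinearMap.single_apply]
  rw [Finset.sum_comm]
  exact Finset.sum_congr rfl fun j _ => hcol j

theorem energyForm_Minv_adj (hMsymm : ∀ k a b, M k a b = M k b a) (A : State E →L[ℝ] CoState E)
    (w v : State E) : energyForm M (Minv M (adj A w)) v = energyForm M w (Minv M (A v)) := by
  rw [energyForm_symm hMsymm w, energyForm_Minv, energyForm_Minv, sum_adj_apply]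

end EnergyForm

section ConstraintProj

variable {ι : ∀ k, E k →L[ℝ] L2 N} {M : ∀ k, E k ≃L[ℝ] StrongDual ℝ (E k)} {u : State E}

theorem toDual_apply (k : Fin K) (a b : E k) : toDual ι k a b = ip ι k a b := rfl

variable (ι M u) in
/-- The denominators `⟨u_k, M_k⁻¹ u_k⟩` by which `coeff` divides do not vanish. -/
def CoeffDefined : Prop := ∀ k, ip ι k (u k) ((M k).symm (toDual ι k (u k))) ≠ 0

theorem coeffDefined_of_ne_zero (hι : ∀ k, Function.Injective (ι k))
    (hMpos : ∀ k a, a ≠ 0 → 0 < M k a a) (hu : ∀ k, u k ≠ 0) : CoeffDefined ι M u := fun k => by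
  have hne : (M k).symm (toDual ι k (u k)) ≠ 0 := fun h => by
    have hzero : ip ι k (u k) (u k) = 0 := by
      rw [← toDual_apply, (map_eq_zero_iff _ (M k).symm.injective).1 h, zero_apply]
    rw [ip, inner_self_eq_zero, map_eq_zero_iff _ (hι k)] at hzero
    exact hu k hzero
  simpa only [ContinuousLinearEquiv.apply_symm_apply, toDual_apply] using (hMpos k _ hne).ne'

theorem coeff_diagOp (hu : CoeffDefined ι M u) (ν : Fin K → ℝ) (k : Fin K) :
    coeff ι M u k (diagOp ι ν u) = ν k := by
  simp only [coeff, diagOp, Minv, smul_apply, ContinuousLinearMap.comp_apply,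
    ContinuousLinearMap.proj_apply, ContinuousLinearMap.coe_pi', ContinuousLinearEquiv.coe_coe,
    map_smul, smul_eq_mul, toDual_apply]
  rw [mul_comm, mul_assoc, mul_inv_cancel₀ (hu k), mul_one]

theorem coeffDiag_diagOp (hu : CoeffDefined ι M u) (ν : Fin K → ℝ) :
    coeffDiag ι M u (diagOp ι ν u) = diagOp ι ν u := by
  calc coeffDiag ι M u (diagOp ι ν u)
      = diagOp ι (fun k => coeff ι M u k (diagOp ι ν u)) u := rfl
    _ = diagOp ι ν u := by simp only [coeff_diagOp hu]

variable (ι M u) in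
/-- The projection of the state space onto `{x | ⟨u_k, x_k⟩ = 0 for all k}`, orthogonal in the
energy form: the tangent space of the constraint of fixed component powers. -/
def constraintProj : State E →L[ℝ] State E :=
  1 - .pi fun k => (((ip ι k (u k) ((M k).symm (toDual ι k (u k))))⁻¹ •
    (toDual ι k (u k)).comp (.proj k)).smulRight ((M k).symm (toDual ι k (u k))))

theorem constraintProj_apply (x : State E) (k : Fin K) :
    constraintProj ι M u x k = x k - ((ip ι k (u k) ((M k).symm (toDual ι k (u k))))⁻¹ *
      ip ι k (u k) (x k)) • (M k).symm (toDual ι k (u k)) := rfl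

theorem ip_constraintProj (hu : CoeffDefined ι M u)
    (x : State E) (k : Fin K) : ip ι k (u k) (constraintProj ι M u x k) = 0 := by
  rw [constraintProj_apply, ← toDual_apply, map_sub, map_smul, toDual_apply, toDual_apply,
    smul_eq_mul, mul_right_comm, inv_mul_cancel₀ (hu k), one_mul, sub_self]

theorem constraintProj_eq_self {x : State E} (hx : ∀ k, ip ι k (u k) (x k) = 0) :
    constraintProj ι M u x = x := by
  ext1 k
  rw [constraintProj_apply, hx k, mul_zero, zero_smul, sub_zero]

theorem constraintProj_eq_self_iff (hu : CoeffDefined ι M u) {x : State E} :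
    constraintProj ι M u x = x ↔ ∀ k, ip ι k (u k) (x k) = 0 :=
  ⟨fun h k => h ▸ ip_constraintProj hu x k, constraintProj_eq_self⟩

theorem constraintProj_mul_self (hu : CoeffDefined ι M u) :
    constraintProj ι M u * constraintProj ι M u = constraintProj ι M u :=
  ContinuousLinearMap.ext fun x => constraintProj_eq_self (ip_constraintProj hu x)

theorem energyForm_constraintProj (hMsymm : ∀ k a b, M k a b = M k b a) (x y : State E) :
    energyForm M (constraintProj ι M u x) y = energyForm M x (constraintProj ι M u y) := by
  simp only [energyForm_apply, constraintProj_apply]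
  refine Finset.sum_congr rfl fun k _ => ?_
  have hnormal : M k (x k) ((M k).symm (toDual ι k (u k))) = ip ι k (u k) (x k) := by
    rw [hMsymm, ContinuousLinearEquiv.apply_symm_apply, toDual_apply]
  simp only [map_sub, map_smul, sub_apply, smul_apply, ContinuousLinearEquiv.apply_symm_apply,
    hnormal, toDual_apply, smul_eq_mul]
  ring

theorem exists_Minv_diagOp_of_constraintProj_eq_zero {x : State E}
    (hx : constraintProj ι M u x = 0) : ∃ ν, Minv M (diagOp ι ν u) = x := by
  refine ⟨fun k => (ip ι k (u k) ((M k).symm (toDual ι k (u k))))⁻¹ * ip ι k (u k) (x k), ?_⟩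
  ext1 k
  have hk := congr_fun hx k
  rw [constraintProj_apply, Pi.zero_apply, sub_eq_zero] at hk
  rw [hk]
  simp [Minv, diagOp]

instance finiteDimensional_ker_constraintProj :
    FiniteDimensional ℝ (constraintProj ι M u).ker := by
  let ips : State E →ₗ[ℝ] Fin K → ℝ :=
    .pi fun k => (toDual ι k (u k)).toLinearMap ∘ₗ .proj k
  refine .of_injective (ips.domRestrict (constraintProj ι M u).ker) ?_
  rw [← LinearMap.ker_eq_bot, LinearMap.ker_eq_bot']
  rintro ⟨x, hx⟩ hips
  exact Subtype.ext ((constraintProj_eq_self fun k => congr_fun hips k).symm.trans hx)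

theorem Minv_sub_coeffDiag (f : CoState E) :
    Minv M (f - coeffDiag ι M u f) = constraintProj ι M u (Minv M f) := by
  ext1 k
  rw [constraintProj_apply]
  simp [Minv, coeffDiag, coeff, toDual_apply]

theorem constraintProj_Minv_diagOp (hu : CoeffDefined ι M u) (ν : Fin K → ℝ) :
    constraintProj ι M u (Minv M (diagOp ι ν u)) = 0 := by
  rw [← Minv_sub_coeffDiag, coeffDiag_diagOp hu, sub_self, map_zero]

theorem LPCV_eq (L00 : State E → CoState E) (μ : Fin K → ℝ) :
    LPCV ι M L00 μ u = -(constraintProj ι M u * (Minv M).comp (adj (L1 ι L00 μ u)) *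
      constraintProj ι M u * (Minv M).comp (L1 ι L00 μ u)) := by
  ext1 x
  have hhat : LhatV ι M L00 μ u x =
      -adj (L1 ι L00 μ u) (Minv M (L1 ι L00 μ u x - coeffDiag ι M u (L1 ι L00 μ u x))) := rfl
  calc LPCV ι M L00 μ u x
      = Minv M (LhatV ι M L00 μ u x - coeffDiag ι M u (LhatV ι M L00 μ u x)) := rfl
    _ = -constraintProj ι M u (Minv M (adj (L1 ι L00 μ u)
          (constraintProj ι M u (Minv M (L1 ι L00 μ u x))))) := by
      rw [Minv_sub_coeffDiag, hhat, Minv_sub_coeffDiag, map_neg, map_neg]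

end ConstraintProj

end

noncomputable section

theorem contDiffAt_clm_pi {X V I : Type*} [Fintype I] {F : I → Type*} [NormedAddCommGroup X]
    [NormedSpace ℝ X] [NormedAddCommGroup V] [NormedSpace ℝ V] [∀ k, NormedAddCommGroup (F k)]
    [∀ k, NormedSpace ℝ (F k)] {f : ∀ k, X → V →L[ℝ] F k} {x : X} {n : WithTop ℕ∞}
    (hf : ∀ k, ContDiffAt ℝ n (f k) x) :
    ContDiffAt ℝ n (fun y => ContinuousLinearMap.pi fun k => f k y) x :=
  (ContinuousLinearMap.piEquivL (𝕜 := ℝ) (E := V) (F := F)).contDiff.contDiffAt.comp x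
    (contDiffAt_pi.2 hf)

theorem eventually_forall_ne_zero {I : Type*} [Finite I] {F : I → Type*} [∀ k, Zero (F k)]
    [∀ k, TopologicalSpace (F k)] [∀ k, T1Space (F k)] {u : ∀ k, F k} (hu : ∀ k, u k ≠ 0) :
    ∀ᶠ v in 𝓝 u, ∀ k, v k ≠ 0 :=
  eventually_all.2 fun k => (continuous_apply k).continuousAt.eventually_ne (hu k)

variable {N K : ℕ} {E : Fin K → Type*} [∀ k, NormedAddCommGroup (E k)] [∀ k, NormedSpace ℝ (E k)]
  {ι : ∀ k, E k →L[ℝ] L2 N} {M : ∀ k, E k ≃L[ℝ] StrongDual ℝ (E k)} {L00 : State E → CoState E}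
  {μ : Fin K → ℝ} {u : State E} {n : WithTop ℕ∞}

section Smoothness

theorem contDiff_component (k : Fin K) : ContDiff ℝ n fun u : State E => u k :=
  (ContinuousLinearMap.proj k : State E →L[ℝ] E k).contDiff

theorem contDiff_adj :
    ContDiff ℝ n (adj : (State E →L[ℝ] CoState E) → State E →L[ℝ] CoState E) := by
  refine contDiff_iff_contDiffAt.2 fun A => contDiffAt_clm_pi (F := fun k => StrongDual ℝ (E k))
    fun k => ContDiffAt.sum fun j _ => ?_
  have hblock : ContDiff ℝ n fun A : State E →L[ℝ] CoState E =>
      ((ContinuousLinearMap.proj j).comp A).comp (ContinuousLinearMap.single ℝ E k) :=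
    (contDiff_const.clm_comp contDiff_id).clm_comp contDiff_const
  have hflip : ContDiff ℝ n fun B => ContinuousLinearMap.flipₗᵢ ℝ (E k) (E j) ℝ B :=
    LinearIsometryEquiv.contDiff _
  exact ((hflip.comp hblock).clm_comp contDiff_const).contDiffAt

theorem contDiff_diagOp : ContDiff ℝ n (diagOp ι) :=
  contDiff_iff_contDiffAt.2 fun _ => contDiffAt_clm_pi fun k =>
    ((contDiff_apply ℝ ℝ k).smul contDiff_const).contDiffAt

theorem contDiff_ip_toDual (k : Fin K) :
    ContDiff ℝ n fun v : State E => ip ι k (v k) ((M k).symm (toDual ι k (v k))) :=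
  ((ι k).contDiff.comp (contDiff_component k)).inner ℝ
    ((ι k).contDiff.comp ((M k).symm.contDiff.comp
      ((toDual ι k).contDiff.comp (contDiff_component k))))

theorem contDiffAt_coeff (hu : CoeffDefined ι M u) (k : Fin K) :
    ContDiffAt ℝ n (fun v => coeff ι M v k) u :=
  (((contDiff_ip_toDual k).contDiffAt.inv (hu k)).smul
    ((toDual ι k).contDiff.comp (contDiff_component k)).contDiffAt).clm_comp contDiffAt_const

theorem contDiffAt_muOf (hu : CoeffDefined ι M u) (hL : ContDiffAt ℝ n L00 u) :
    ContDiffAt ℝ n (muOf ι M L00) u :=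
  contDiffAt_pi.2 fun k => (contDiffAt_coeff hu k).clm_apply hL

theorem contDiffAt_constraintProj (hu : CoeffDefined ι M u) :
    ContDiffAt ℝ n (constraintProj ι M) u := by
  refine contDiffAt_const.sub (contDiffAt_clm_pi fun k => ?_)
  have hdual : ContDiff ℝ n fun v : State E => toDual ι k (v k) :=
    (toDual ι k).contDiff.comp (contDiff_component k)
  have hfunctional := ((contDiff_ip_toDual k).contDiffAt.inv (hu k)).smul
    (hdual.clm_comp (contDiff_const (c := ContinuousLinearMap.proj k))).contDiffAt
  exact hfunctional.smulRight ((M k).symm.contDiff.comp hdual).contDiffAt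

theorem L1_eq (h : DifferentiableAt ℝ L00 u) : L1 ι L00 μ u = fderiv ℝ L00 u - diagOp ι μ :=
  (h.hasFDerivAt.sub (diagOp ι μ).hasFDerivAt).fderiv

theorem contDiffAt_L0 (hL : ContDiffAt ℝ n L00 u) : ContDiffAt ℝ n (L0 ι L00 μ) u :=
  hL.sub (diagOp ι μ).contDiff.contDiffAt

theorem contDiffAt_L1 (hu : CoeffDefined ι M u) (hL : ContDiffAt ℝ 2 L00 u) :
    ContDiffAt ℝ 1 (fun v => L1 ι L00 (muOf ι M L00 v) v) u := by
  have hdiff : ContDiffAt ℝ 1 (fun v => fderiv ℝ L00 v - diagOp ι (muOf ι M L00 v)) u :=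
    (hL.fderiv_right (by norm_num)).sub
      ((contDiff_diagOp (ι := ι)).contDiffAt.comp u (contDiffAt_muOf hu (hL.of_le (by norm_num))))
  refine hdiff.congr_of_eventuallyEq ?_
  filter_upwards [hL.eventually (by norm_num)] with v hv
  exact L1_eq (hv.differentiableAt two_ne_zero)

end Smoothness

section Increment

variable (ι M L00 u) in
/-- The operator that turns `L₀ u` into the increment of the scheme. Since `M⁻¹ diag(ν) u` is
normal to the constraint, the propagation constants in `L₀` do not matter here, and the scheme
becomes `û = u - incrementOp u (L₀ u) Δt` with a fixed `μ` in `L₀`. -/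
def incrementOp : CoState E →L[ℝ] State E :=
  (constraintProj ι M u * (Minv M).comp (adj (L1 ι L00 (muOf ι M L00 u) u)) *
    constraintProj ι M u).comp (Minv M)

theorem contDiffAt_incrementOp (hu : CoeffDefined ι M u) (hL : ContDiffAt ℝ 2 L00 u) :
    ContDiffAt ℝ 1 (incrementOp ι M L00) u := by
  have hadj : ContDiffAt ℝ 1 (fun v => adj (L1 ι L00 (muOf ι M L00 v) v)) u :=
    (contDiff_adj (E := E)).contDiffAt.comp u (contDiffAt_L1 hu hL)
  exact (((contDiffAt_constraintProj hu).clm_comp (contDiffAt_const.clm_comp hadj)).clm_comp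
    (contDiffAt_constraintProj hu)).clm_comp contDiffAt_const

theorem Minv_L0_muOf (hu : CoeffDefined ι M u) :
    Minv M (L0 ι L00 (muOf ι M L00 u) u) = constraintProj ι M u (Minv M (L0 ι L00 μ u)) := by
  calc Minv M (L0 ι L00 (muOf ι M L00 u) u)
      = Minv M (L00 u - coeffDiag ι M u (L00 u)) := rfl
    _ = constraintProj ι M u (Minv M (L0 ι L00 μ u)) := by
      rw [Minv_sub_coeffDiag, L0, map_sub, map_sub, constraintProj_Minv_diagOp hu, sub_zero]

theorem hatStep_eq (hu : CoeffDefined ι M u) (Δt : ℝ) :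
    hatStep ι M L00 Δt u = u - Δt • incrementOp ι M L00 u (L0 ι L00 μ u) := by
  have hincr : Minv M (residual ι M L00 u - diagOp ι (gammaOf ι M L00 u) u) =
      constraintProj ι M u (Minv M (residual ι M L00 u)) := Minv_sub_coeffDiag _
  rw [hatStep, hincr, residual, Minv_L0_muOf hu (μ := μ)]
  rfl

theorem muOf_eq (hu : CoeffDefined ι M u) (h0 : L0 ι L00 μ u = 0) : muOf ι M L00 u = μ := by
  funext k
  rw [muOf, sub_eq_zero.1 h0, coeff_diagOp hu]

theorem hatStep_eq_self (hu : CoeffDefined ι M u) (h0 : L0 ι L00 μ u = 0) (Δt : ℝ) :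
    hatStep ι M L00 Δt u = u := by
  rw [hatStep_eq hu, h0, map_zero, smul_zero, sub_zero]

end Increment

section Rescale

variable (ι) in
/-- Rescaling of the components to the prescribed powers `P`. -/
def rescale (P : Fin K → ℝ) (y : State E) : State E := fun k => √(P k / power ι y k) • y k

variable (ι u) in
/-- The linearization of the rescaling at a wave `u` with the prescribed powers. -/
def rescaleDeriv : State E →L[ℝ] State E :=
  1 - .pi fun k => (((power ι u k)⁻¹ • (toDual ι k (u k)).comp (.proj k)).smulRight (u k))

theorem rescaleDeriv_apply (x : State E) (k : Fin K) :
    rescaleDeriv ι u x k = x k - ((power ι u k)⁻¹ * ip ι k (u k) (x k)) • u k := rfl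

theorem ip_rescaleDeriv (hP : ∀ k, power ι u k ≠ 0) (x : State E) (k : Fin K) :
    ip ι k (u k) (rescaleDeriv ι u x k) = 0 := by
  rw [rescaleDeriv_apply, ← toDual_apply, map_sub, map_smul, toDual_apply, toDual_apply,
    ← power, smul_eq_mul, mul_right_comm, inv_mul_cancel₀ (hP k), one_mul, sub_self]

theorem rescaleDeriv_eq_self {x : State E} (hx : ∀ k, ip ι k (u k) (x k) = 0) :
    rescaleDeriv ι u x = x := by
  ext1 k
  rw [rescaleDeriv_apply, hx k, mul_zero, zero_smul, sub_zero]

theorem power_ne_zero (hι : ∀ k, Function.Injective (ι k)) (hu : ∀ k, u k ≠ 0) (k : Fin K) :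
    power ι u k ≠ 0 :=
  inner_self_ne_zero.2 ((map_ne_zero_iff _ (hι k)).2 (hu k))

theorem rescale_eq_self (hP : ∀ k, power ι u k ≠ 0) : rescale ι (power ι u) u = u := by
  ext1 k
  rw [rescale, div_self (hP k), Real.sqrt_one, one_smul]

theorem hasFDerivAt_power (k : Fin K) :
    HasFDerivAt (fun u : State E => power ι u k)
      ((2 : ℝ) • (toDual ι k (u k)).comp (ContinuousLinearMap.proj k)) u := by
  have hcomp : HasFDerivAt (fun u : State E => ι k (u k))
      ((ι k).comp (ContinuousLinearMap.proj k : State E →L[ℝ] E k)) u :=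
    ((ι k).comp (ContinuousLinearMap.proj k : State E →L[ℝ] E k)).hasFDerivAt
  refine (hcomp.inner ℝ hcomp).congr_fderiv ?_
  ext1 x
  simp only [ContinuousLinearMap.comp_apply, ContinuousLinearMap.prod_apply, fderivInnerCLM_apply,
    ContinuousLinearMap.proj_apply, smul_apply, toDual_apply, smul_eq_mul, ip]
  rw [real_inner_comm (ι k (u k)) (ι k (x k)), two_mul]

theorem contDiffAt_rescale (hP : ∀ k, power ι u k ≠ 0) :
    ContDiffAt ℝ n (rescale ι (power ι u)) u := by
  refine contDiffAt_pi.2 fun k => ContDiffAt.smul ?_ (contDiff_component k).contDiffAt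
  have hcomp : ContDiff ℝ n fun v : State E => ι k (v k) :=
    (ι k).contDiff.comp (contDiff_component k)
  refine ContDiffAt.sqrt (contDiffAt_const.div (hcomp.inner ℝ hcomp).contDiffAt (hP k)) ?_
  exact (div_self (hP k)).trans_ne one_ne_zero

theorem fderiv_rescale (hP : ∀ k, power ι u k ≠ 0) :
    fderiv ℝ (rescale ι (power ι u)) u = rescaleDeriv ι u := by
  refine HasFDerivAt.fderiv (hasFDerivAt_pi'.2 fun k => ?_)
  have hratio : HasFDerivAt (fun v : State E => power ι u k * (power ι v k)⁻¹) _ u :=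
    ((hasDerivAt_inv (hP k)).comp_hasFDerivAt u (hasFDerivAt_power k)).const_mul _
  have hone : power ι u k * (power ι u k)⁻¹ = 1 := mul_inv_cancel₀ (hP k)
  refine ((hratio.sqrt (hone.trans_ne one_ne_zero)).smul
    (ContinuousLinearMap.proj k : State E →L[ℝ] E k).hasFDerivAt).congr_fderiv ?_
  ext1 x
  simp only [hone, Real.sqrt_one, ContinuousLinearMap.comp_apply, ContinuousLinearMap.proj_apply,
    rescaleDeriv_apply, add_apply, smul_apply, ContinuousLinearMap.smulRight_apply, toDual_apply,
    smul_eq_mul]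
  rw [one_smul, sub_eq_add_neg, ← neg_smul]
  congr 2
  field_simp [hP k]

end Rescale

section Step

theorem step_eq_rescale (P : Fin K → ℝ) (Δt : ℝ) :
    step ι M L00 P Δt = rescale ι P ∘ hatStep ι M L00 Δt := rfl

theorem step_eq_self (hu : CoeffDefined ι M u) (hP : ∀ k, power ι u k ≠ 0)
    (h0 : L0 ι L00 μ u = 0) (Δt : ℝ) : step ι M L00 (power ι u) Δt u = u := by
  rw [step_eq_rescale, Function.comp_apply, hatStep_eq_self hu h0, rescale_eq_self hP]

variable (ι M L00 μ u) in
/-- The linearization of `hatStep` at a wave `u` with propagation constants `μ`. -/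
def hatStepDeriv (Δt : ℝ) : State E →L[ℝ] State E :=
  1 - Δt • (incrementOp ι M L00 u).comp (L1 ι L00 μ u)

variable (ι M L00 μ u) in
/-- The linearization of the scheme at a wave `u` with propagation constants `μ`. -/
def stepDeriv (Δt : ℝ) : State E →L[ℝ] State E :=
  (rescaleDeriv ι u).comp (hatStepDeriv ι M L00 μ u Δt)

theorem eventually_coeffDefined (hu : CoeffDefined ι M u) : ∀ᶠ v in 𝓝 u, CoeffDefined ι M v :=
  eventually_all.2 fun k =>
    (contDiff_ip_toDual (n := 0) k).continuous.continuousAt.eventually_ne (hu k)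

theorem hatStep_eventuallyEq (hu : CoeffDefined ι M u) (Δt : ℝ) :
    hatStep ι M L00 Δt =ᶠ[𝓝 u] fun v => v - Δt • incrementOp ι M L00 v (L0 ι L00 μ v) :=
  (eventually_coeffDefined hu).mono fun _ hv => hatStep_eq hv Δt

theorem hasStrictFDerivAt_hatStep (hu : CoeffDefined ι M u) (hL : ContDiffAt ℝ 2 L00 u)
    (h0 : L0 ι L00 μ u = 0) (Δt : ℝ) :
    HasStrictFDerivAt (hatStep ι M L00 Δt) (hatStepDeriv ι M L00 μ u Δt) u :=
  (hasStrictFDerivAt_sub_smul_clm_apply (contDiffAt_incrementOp hu hL)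
    (contDiffAt_L0 (hL.of_le one_le_two)) h0 Δt).congr_of_eventuallyEq
      (hatStep_eventuallyEq hu Δt).symm

theorem hasStrictFDerivAt_step (hu : CoeffDefined ι M u) (hP : ∀ k, power ι u k ≠ 0)
    (hL : ContDiffAt ℝ 2 L00 u) (h0 : L0 ι L00 μ u = 0) (Δt : ℝ) :
    HasStrictFDerivAt (step ι M L00 (power ι u) Δt) (stepDeriv ι M L00 μ u Δt) u := by
  have hrescale : HasStrictFDerivAt (rescale ι (power ι u)) (rescaleDeriv ι u)
      (hatStep ι M L00 Δt u) := by
    rw [hatStep_eq_self hu h0, ← fderiv_rescale hP]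
    exact (contDiffAt_rescale hP).hasStrictFDerivAt one_ne_zero
  exact hrescale.comp u (hasStrictFDerivAt_hatStep hu hL h0 Δt)

theorem hasQuadraticExpansionAt_step (hu : CoeffDefined ι M u) (hP : ∀ k, power ι u k ≠ 0)
    (hL : ContDiffAt ℝ 2 L00 u) (h0 : L0 ι L00 μ u = 0) (Δt : ℝ) :
    HasQuadraticExpansionAt (step ι M L00 (power ι u) Δt) (stepDeriv ι M L00 μ u Δt) u := by
  have hhat : HasQuadraticExpansionAt (hatStep ι M L00 Δt) (hatStepDeriv ι M L00 μ u Δt) u :=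
    (hasQuadraticExpansionAt_sub_smul_clm_apply (contDiffAt_incrementOp hu hL) (contDiffAt_L0 hL)
      h0 Δt).congr_of_eventuallyEq (hatStep_eventuallyEq hu Δt)
  have hrescale : HasQuadraticExpansionAt (rescale ι (power ι u)) (rescaleDeriv ι u)
      (hatStep ι M L00 Δt u) := by
    rw [hatStep_eq_self hu h0, ← fderiv_rescale hP]
    exact hasQuadraticExpansionAt_of_contDiffAt (contDiffAt_rescale hP)
  exact hrescale.comp hhat

theorem eventually_stepDefined (hu : ∀ k, u k ≠ 0) (hcoeff : CoeffDefined ι M u)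
    (hL : ContDiffAt ℝ 2 L00 u) (h0 : L0 ι L00 μ u = 0) (Δt : ℝ) :
    ∀ᶠ v in 𝓝 u, StepDefined ι M L00 Δt v := by
  have hlim : Tendsto (hatStep ι M L00 Δt) (𝓝 u) (𝓝 u) := by
    simpa only [ContinuousAt, hatStep_eq_self hcoeff h0] using
      (hasStrictFDerivAt_hatStep hcoeff hL h0 Δt).continuousAt
  filter_upwards [hL.eventually (by norm_num), eventually_forall_ne_zero hu,
    hlim.eventually (eventually_forall_ne_zero hu)] with v hsmooth hv hhat
  exact ⟨hsmooth.differentiableAt two_ne_zero, fun k => ⟨hv k, hhat k⟩⟩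

theorem isLinearizedStep_stepDeriv (hMsymm : ∀ k a b, M k a b = M k b a)
    (hMpos : ∀ k a, a ≠ 0 → 0 < M k a a) (hu : CoeffDefined ι M u) (hP : ∀ k, power ι u k ≠ 0)
    (h0 : L0 ι L00 μ u = 0) (Δt : ℝ) :
    IsLinearizedStep (energyForm M) ((Minv M).comp (L1 ι L00 μ u))
      ((Minv M).comp (adj (L1 ι L00 μ u))) (constraintProj ι M u) (stepDeriv ι M L00 μ u Δt)
      Δt where
  coercive := isCoercive_energyForm hMsymm hMpos
  form_symm := energyForm_symm hMsymm
  adjoint := energyForm_Minv_adj hMsymm _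
  proj_proj := constraintProj_mul_self hu
  proj_symm := energyForm_constraintProj hMsymm
  proj_step := ContinuousLinearMap.ext fun _ => constraintProj_eq_self (ip_rescaleDeriv hP _)
  step_proj := by
    ext1 x
    have hhat : hatStepDeriv ι M L00 μ u Δt (constraintProj ι M u x) =
        constraintProj ι M u (x - Δt • (Minv M (adj (L1 ι L00 μ u) (constraintProj ι M u
          (Minv M (L1 ι L00 μ u (constraintProj ι M u x))))))) := by
      rw [map_sub, map_smul, hatStepDeriv, incrementOp, muOf_eq hu h0]
      rfl
    calc stepDeriv ι M L00 μ u Δt (constraintProj ι M u x)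
        = hatStepDeriv ι M L00 μ u Δt (constraintProj ι M u x) :=
          rescaleDeriv_eq_self (hhat ▸ ip_constraintProj hu _)
      _ = _ := by rw [hhat, map_sub, map_smul]; rfl

end Step

end

noncomputable section

theorem eventually_eq_of_eventually_hasFDerivAt_zero {V F : Type*} [NormedAddCommGroup V]
    [NormedSpace ℝ V] [NormedAddCommGroup F] [NormedSpace ℝ F] {f : V → F} {v : V}
    (hf : ∀ᶠ w in 𝓝 v, HasFDerivAt f (0 : V →L[ℝ] F) w) : ∀ᶠ w in 𝓝 v, f w = f v := by
  obtain ⟨r, hr, hball⟩ := Metric.eventually_nhds_iff_ball.1 hf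
  filter_upwards [Metric.ball_mem_nhds v hr] with w hw
  exact Metric.isOpen_ball.is_const_of_fderiv_eq_zero (convex_ball v r).isPreconnected
    (fun x hx => (hball x hx).differentiableAt.differentiableWithinAt)
    (fun x hx => (hball x hx).fderiv) hw (Metric.mem_ball_self hr)

variable {N K s : ℕ} {E : Fin K → Type*} [∀ k, NormedAddCommGroup (E k)]
  [∀ k, NormedSpace ℝ (E k)] {ι : ∀ k, E k →L[ℝ] L2 N} {M : ∀ k, E k ≃L[ℝ] StrongDual ℝ (E k)}
  {L00 : State E → CoState E} {φ : (Fin K → ℝ) × (Fin s → ℝ) → State E}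
  {U : Set ((Fin K → ℝ) × (Fin s → ℝ))} {μ : Fin K → ℝ} {c : Fin s → ℝ}

theorem Minv_injective : Function.Injective (Minv M) :=
  (ContinuousLinearEquiv.piCongrRight fun k => (M k).symm).injective

theorem isClosed_range_Minv_comp {A : State E →L[ℝ] CoState E} (hA : IsClosed (Set.range A)) :
    IsClosed (Set.range ((Minv M).comp A)) := by
  rw [ContinuousLinearMap.coe_comp, Set.range_comp]
  exact (ContinuousLinearEquiv.piCongrRight fun k => (M k).symm).toHomeomorph.isClosedMap _ hA

section Powers

variable {V : Type*} [NormedAddCommGroup V] [NormedSpace ℝ V]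

theorem hasFDerivAt_diagOp_sub {f : (Fin K → ℝ) → State E} (hf : DifferentiableAt ℝ f μ) :
    HasFDerivAt (fun ν => diagOp ι (ν - μ) (f ν)) (ContinuousLinearMap.pi fun k =>
      (ContinuousLinearMap.proj k : (Fin K → ℝ) →L[ℝ] ℝ).smulRight (toDual ι k (f μ k))) μ := by
  refine hasFDerivAt_pi.2 fun k => ?_
  have hscalar : HasFDerivAt (fun ν : Fin K → ℝ => ν k - μ k)
      (ContinuousLinearMap.proj k : (Fin K → ℝ) →L[ℝ] ℝ) μ :=
    (ContinuousLinearMap.proj k : (Fin K → ℝ) →L[ℝ] ℝ).hasFDerivAt.sub_const (μ k)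
  have hdual := (toDual ι k).hasFDerivAt.comp μ (hasFDerivAt_pi'.1 hf.hasFDerivAt k)
  refine (hscalar.smul hdual).congr_fderiv ?_
  rw [sub_self, zero_smul, zero_add]
  rfl

theorem hasFDerivAt_power_comp {f : V → State E} {v : V} (hf : DifferentiableAt ℝ f v)
    (k : Fin K) : HasFDerivAt (fun w => power ι (f w) k)
      (((2 : ℝ) • (toDual ι k (f v k)).comp (ContinuousLinearMap.proj k)).comp (fderiv ℝ f v)) v :=
  HasFDerivAt.comp (g := fun u => power ι u k) v (hasFDerivAt_power k) hf.hasFDerivAt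

theorem powerJacobian_mulVec (hφ : DifferentiableAt ℝ (fun ν => φ (ν, c)) μ) (ν : Fin K → ℝ)
    (k : Fin K) : (powerJacobian ι φ μ c).mulVec ν k =
      2 * ip ι k (φ (μ, c) k) (fderiv ℝ (fun κ => φ (κ, c)) μ ν k) := by
  calc (powerJacobian ι φ μ c).mulVec ν k
      = ∑ j, ν j • fderiv ℝ (fun κ => power ι (φ (κ, c)) k) μ (Pi.single j 1) := by
        simp only [Matrix.mulVec, dotProduct, powerJacobian, Matrix.of_apply, smul_eq_mul,
          mul_comm (ν _)]
    _ = fderiv ℝ (fun κ => power ι (φ (κ, c)) k) μ ν := by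
        conv_rhs => rw [pi_eq_sum_univ' ν, map_sum]
        simp only [map_smul]
    _ = _ := by rw [(hasFDerivAt_power_comp hφ k).fderiv]; rfl

theorem eq_zero_of_ip_deriv_eq_zero (hφ : DifferentiableAt ℝ (fun ν => φ (ν, c)) μ)
    (hD : (powerJacobian ι φ μ c).det ≠ 0) {ν : Fin K → ℝ}
    (hν : ∀ k, ip ι k (φ (μ, c) k) (fderiv ℝ (fun κ => φ (κ, c)) μ ν k) = 0) : ν = 0 :=
  Matrix.eq_zero_of_mulVec_eq_zero hD <| funext fun k => by
    rw [powerJacobian_mulVec hφ, hν, mul_zero, Pi.zero_apply]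

theorem ne_zero_of_det_powerJacobian (hφ : DifferentiableAt ℝ (fun ν => φ (ν, c)) μ)
    (hD : (powerJacobian ι φ μ c).det ≠ 0) (k : Fin K) : φ (μ, c) k ≠ 0 := fun hk =>
  hD <| Matrix.det_eq_zero_of_row_eq_zero k fun j => by
    have hentry := (powerJacobian_mulVec (ι := ι) hφ (Pi.single j 1) k).symm
    rwa [hk, ip, map_zero, inner_zero_left, mul_zero, Matrix.mulVec_single_one, Matrix.col_apply,
      eq_comm] at hentry

end Powers

/-- `φ` is a `C¹` family of solitary waves, parametrized by the propagation constants `μ` and the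
free parameters `c` with `(μ, c)` in the open set `U`. -/
structure IsWaveFamily (ι : ∀ k, E k →L[ℝ] L2 N) (L00 : State E → CoState E)
    (φ : (Fin K → ℝ) × (Fin s → ℝ) → State E) (U : Set ((Fin K → ℝ) × (Fin s → ℝ))) : Prop where
  isOpen : IsOpen U
  contDiffOn : ContDiffOn ℝ 1 φ U
  L0_eq_zero : ∀ p ∈ U, L0 ι L00 p.1 (φ p) = 0

namespace IsWaveFamily

theorem differentiableAt_left (hφ : IsWaveFamily ι L00 φ U) (h : (μ, c) ∈ U) :
    DifferentiableAt ℝ (fun ν => φ (ν, c)) μ :=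
  ((hφ.contDiffOn.contDiffAt (hφ.isOpen.mem_nhds h)).differentiableAt one_ne_zero).comp μ
    (differentiableAt_id.prodMk (differentiableAt_const c))

theorem contDiffAt_right (hφ : IsWaveFamily ι L00 φ U) (h : (μ, c) ∈ U) :
    ContDiffAt ℝ 1 (fun d => φ (μ, d)) c :=
  (hφ.contDiffOn.contDiffAt (hφ.isOpen.mem_nhds h)).comp c (contDiffAt_const.prodMk contDiffAt_id)

theorem differentiableAt_right (hφ : IsWaveFamily ι L00 φ U) (h : (μ, c) ∈ U) :
    DifferentiableAt ℝ (fun d => φ (μ, d)) c :=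
  (hφ.contDiffAt_right h).differentiableAt one_ne_zero

theorem eventually_mem_right (hφ : IsWaveFamily ι L00 φ U) (h : (μ, c) ∈ U) :
    ∀ᶠ d in 𝓝 c, (μ, d) ∈ U :=
  (Continuous.prodMk_right μ).continuousAt.eventually_mem (hφ.isOpen.mem_nhds h)

theorem L1_apply_deriv_left (hφ : IsWaveFamily ι L00 φ U) (h : (μ, c) ∈ U)
    (hL : DifferentiableAt ℝ L00 (φ (μ, c))) (ν : Fin K → ℝ) :
    L1 ι L00 μ (φ (μ, c)) (fderiv ℝ (fun κ => φ (κ, c)) μ ν) = diagOp ι ν (φ (μ, c)) := by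
  have hdiff := hφ.differentiableAt_left h
  have hL0 : HasFDerivAt (L0 ι L00 μ) (L1 ι L00 μ (φ (μ, c))) (φ (μ, c)) :=
    (hL.sub (diagOp ι μ).differentiableAt).hasFDerivAt
  have hsol : (fun κ => L0 ι L00 μ (φ (κ, c))) =ᶠ[𝓝 μ]
      fun κ => diagOp ι (κ - μ) (φ (κ, c)) := by
    filter_upwards [(Continuous.prodMk_left c).continuousAt.eventually_mem
      (hφ.isOpen.mem_nhds h)] with κ hκ
    rw [L0, sub_eq_zero.1 (hφ.L0_eq_zero _ hκ)]
    ext1 k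
    exact (sub_smul (κ k) (μ k) (toDual ι k (φ (κ, c) k))).symm
  have hderiv := ((hasFDerivAt_diagOp_sub hdiff).congr_of_eventuallyEq hsol).unique
    (HasFDerivAt.comp (g := L0 ι L00 μ) μ hL0 hdiff.hasFDerivAt)
  exact congr($hderiv.symm ν)

theorem L1_apply_deriv_right (hφ : IsWaveFamily ι L00 φ U) (h : (μ, c) ∈ U)
    (hL : DifferentiableAt ℝ L00 (φ (μ, c))) (w : Fin s → ℝ) :
    L1 ι L00 μ (φ (μ, c)) (fderiv ℝ (fun d => φ (μ, d)) c w) = 0 := by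
  have hL0 : HasFDerivAt (L0 ι L00 μ) (L1 ι L00 μ (φ (μ, c))) (φ (μ, c)) :=
    (hL.sub (diagOp ι μ).differentiableAt).hasFDerivAt
  have hsol : (fun d => L0 ι L00 μ (φ (μ, d))) =ᶠ[𝓝 c] fun _ => 0 :=
    (hφ.eventually_mem_right h).mono fun d hd => hφ.L0_eq_zero _ hd
  have hderiv := ((hasFDerivAt_const 0 c).congr_of_eventuallyEq hsol).unique
    (HasFDerivAt.comp (g := L0 ι L00 μ) c hL0 (hφ.differentiableAt_right h).hasFDerivAt)
  exact congr($hderiv.symm w)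

theorem eventually_power_eq (hφ : IsWaveFamily ι L00 φ U) (h : (μ, c) ∈ U)
    (hL : ContDiffAt ℝ 2 L00 (φ (μ, c)))
    (horth : ∀ d, (μ, d) ∈ U → ∀ ψ, L1 ι L00 μ (φ (μ, d)) ψ = 0 →
      ∀ k, ip ι k (φ (μ, d) k) (ψ k) = 0) :
    ∀ᶠ d in 𝓝 c, power ι (φ (μ, d)) = power ι (φ (μ, c)) := by
  have hsmooth : ∀ᶠ d in 𝓝 c, ContDiffAt ℝ 2 L00 (φ (μ, d)) :=
    (hφ.contDiffAt_right h).continuousAt.eventually (hL.eventually (by norm_num))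
  have hconst (k : Fin K) : ∀ᶠ d in 𝓝 c, power ι (φ (μ, d)) k = power ι (φ (μ, c)) k := by
    refine eventually_eq_of_eventually_hasFDerivAt_zero
      (f := fun d => power ι (φ (μ, d)) k) ?_
    filter_upwards [hsmooth, hφ.eventually_mem_right h] with d hLd hd
    refine (hasFDerivAt_power_comp (hφ.differentiableAt_right hd) k).congr_fderiv ?_
    ext1 w
    have hzero := horth d hd _
      (hφ.L1_apply_deriv_right hd (hLd.differentiableAt two_ne_zero) w) k
    exact (congrArg (2 * ·) hzero).trans (mul_zero 2)
  exact (eventually_all.2 hconst).mono fun d hd => funext hd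

end IsWaveFamily

theorem range_fderiv_eq_span_mode (φ : (Fin K → ℝ) × (Fin s → ℝ) → State E) (μ : Fin K → ℝ)
    (c : Fin s → ℝ) :
    (fderiv ℝ (fun d => φ (μ, d)) c).range = Submodule.span ℝ (Set.range (mode φ μ c)) := by
  rw [LinearMap.range_eq_map, ← (Pi.basisFun ℝ (Fin s)).span_eq, Submodule.map_span,
    ← Set.range_comp]
  congr 2
  funext j
  simp [mode]

/-- The assumptions on the wave `φ (μ, c)`: the kernel of its linearized operator consists of the
invariance modes and the range is closed, the waves with propagation constants `μ` are orthogonal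
to the kernels of their linearized operators, and the powers are independent functions of `μ`. -/
structure IsNondegenerateWave (ι : ∀ k, E k →L[ℝ] L2 N) (L00 : State E → CoState E)
    (φ : (Fin K → ℝ) × (Fin s → ℝ) → State E) (U : Set ((Fin K → ℝ) × (Fin s → ℝ)))
    (μ : Fin K → ℝ) (c : Fin s → ℝ) : Prop where
  isWaveFamily : IsWaveFamily ι L00 φ U
  mem : (μ, c) ∈ U
  contDiffAt : ContDiffAt ℝ 2 L00 (φ (μ, c))
  ker_eq : (L1 ι L00 μ (φ (μ, c))).ker = Submodule.span ℝ (Set.range (mode φ μ c))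
  isClosed_range : IsClosed (Set.range (L1 ι L00 μ (φ (μ, c))))
  ip_eq_zero : ∀ d, (μ, d) ∈ U → ∀ ψ, L1 ι L00 μ (φ (μ, d)) ψ = 0 →
    ∀ k, ip ι k (φ (μ, d) k) (ψ k) = 0
  det_ne_zero : (powerJacobian ι φ μ c).det ≠ 0

namespace IsNondegenerateWave

variable (h : IsNondegenerateWave ι L00 φ U μ c)
include h

theorem ne_zero (k : Fin K) : φ (μ, c) k ≠ 0 :=
  ne_zero_of_det_powerJacobian (h.isWaveFamily.differentiableAt_left h.mem) h.det_ne_zero k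

theorem L0_eq_zero : L0 ι L00 μ (φ (μ, c)) = 0 := h.isWaveFamily.L0_eq_zero _ h.mem

theorem ker_Minv_comp_L1 : ((Minv M).comp (L1 ι L00 μ (φ (μ, c)))).ker =
    (fderiv ℝ (fun d => φ (μ, d)) c).range := by
  rw [range_fderiv_eq_span_mode, ← h.ker_eq]
  ext x
  exact map_eq_zero_iff (Minv M) Minv_injective

theorem constraintProj_eq_self {x : State E}
    (hx : (Minv M).comp (L1 ι L00 μ (φ (μ, c))) x = 0) :
    constraintProj ι M (φ (μ, c)) x = x :=
  PCSOM.constraintProj_eq_self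
    (h.ip_eq_zero c h.mem x ((map_eq_zero_iff (Minv M) Minv_injective).1 hx))

theorem exists_lower_bound [∀ k, CompleteSpace (E k)] (hu : CoeffDefined ι M (φ (μ, c))) :
    ∃ C, ∀ w, constraintProj ι M (φ (μ, c)) w = w →
      ∃ g, (Minv M).comp (L1 ι L00 μ (φ (μ, c))) g = 0 ∧
        ‖w - g‖ ≤ C *
          ‖constraintProj ι M (φ (μ, c)) ((Minv M).comp (L1 ι L00 μ (φ (μ, c))) w)‖ := by
  refine exists_lower_bound_of_isClosed_range (isClosed_range_Minv_comp h.isClosed_range)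
    (constraintProj_mul_self hu) (fun _ => h.constraintProj_eq_self)
    (m := fderiv ℝ (fun ν => φ (ν, c)) μ) (fun x hx => ?_) fun ν hν => ?_
  · obtain ⟨ν, rfl⟩ := exists_Minv_diagOp_of_constraintProj_eq_zero hx
    exact ⟨ν, congrArg (Minv M) (h.isWaveFamily.L1_apply_deriv_left h.mem
      (h.contDiffAt.differentiableAt two_ne_zero) ν)⟩
  · exact eq_zero_of_ip_deriv_eq_zero (h.isWaveFamily.differentiableAt_left h.mem) h.det_ne_zero
      ((constraintProj_eq_self_iff hu).1 hν)

theorem compression_ne_zero [∀ k, CompleteSpace (E k)] (hX : ¬ FiniteDimensional ℝ (State E))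
    (hu : CoeffDefined ι M (φ (μ, c))) :
    constraintProj ι M (φ (μ, c)) * (Minv M).comp (L1 ι L00 μ (φ (μ, c))) *
      constraintProj ι M (φ (μ, c)) ≠ 0 := by
  obtain ⟨C, hC⟩ := h.exists_lower_bound hu
  have : FiniteDimensional ℝ ((Minv M).comp (L1 ι L00 μ (φ (μ, c)))).ker := by
    rw [h.ker_Minv_comp_L1]
    infer_instance
  exact PCSOM.compression_ne_zero hX (constraintProj_mul_self hu) hC

theorem eventually_step_eq_self (hι : ∀ k, Function.Injective (ι k))
    (hu : CoeffDefined ι M (φ (μ, c))) (Δt : ℝ) :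
    ∀ᶠ d in 𝓝 c, step ι M L00 (power ι (φ (μ, c))) Δt (φ (μ, d)) = φ (μ, d) := by
  have hlim := (h.isWaveFamily.contDiffAt_right h.mem).continuousAt
  filter_upwards [h.isWaveFamily.eventually_power_eq h.mem h.contDiffAt h.ip_eq_zero,
    h.isWaveFamily.eventually_mem_right h.mem, hlim.eventually (eventually_coeffDefined hu),
    hlim.eventually (eventually_forall_ne_zero h.ne_zero)] with d hpow hd hcoeff hne
  rw [← hpow]
  exact step_eq_self hcoeff (power_ne_zero hι hne) (h.isWaveFamily.L0_eq_zero _ hd) Δt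

variable [∀ k, CompleteSpace (E k)] (hX : ¬ FiniteDimensional ℝ (State E))
  (hι : ∀ k, Function.Injective (ι k)) (hMsymm : ∀ k a b, M k a b = M k b a)
  (hMpos : ∀ k a, a ≠ 0 → 0 < M k a a) {Δt : ℝ}
include hX hι hMsymm hMpos

theorem eventually_iter_tendsto (hΔt : 0 < Δt) (hΛ : Δt < -2 / LambdaMin ι M L00 μ (φ (μ, c)))
    {S : Set (State E)} (hS : S ∈ 𝓝 (φ (μ, c))) {W : Set (Fin s → ℝ)} (hW : W ∈ 𝓝 c) :
    ∀ᶠ u₀ in 𝓝 (φ (μ, c)),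
      (∀ n, iter ι M L00 (power ι (φ (μ, c))) Δt u₀ n ∈ S) ∧
      ∃ d ∈ W, Tendsto (iter ι M L00 (power ι (φ (μ, c))) Δt u₀) atTop (𝓝 (φ (μ, d))) := by
  have hu : CoeffDefined ι M (φ (μ, c)) := coeffDefined_of_ne_zero hι hMpos h.ne_zero
  have hP := power_ne_zero hι h.ne_zero
  obtain ⟨C, hC⟩ := h.exists_lower_bound hu
  rw [LambdaMin, LPCV_eq] at hΛ
  obtain ⟨G, hG, p, a, b, q, hp, hq1, hq⟩ :=
    (isLinearizedStep_stepDeriv hMsymm hMpos hu hP h.L0_eq_zero Δt).exists_contraction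
      (h.compression_ne_zero hX hu) hΔt hΛ (fun _ => h.constraintProj_eq_self) hC
  obtain ⟨R, hR⟩ := exists_factor_through (fderiv ℝ (fun d => φ (μ, d)) c) G fun x => by
    rw [← h.ker_Minv_comp_L1 (M := M)]
    exact hG x
  exact eventually_iterate_tendsto_fixed_manifold (σ := fun d => φ (μ, d))
    (hasStrictFDerivAt_step hu hP h.contDiffAt h.L0_eq_zero Δt)
    ((h.isWaveFamily.contDiffAt_right h.mem).hasStrictFDerivAt one_ne_zero)
    (h.eventually_step_eq_self hι hu Δt) hp (fun y => by rw [hR]; exact hq y) hq1 hS hW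

theorem exists_iter_far (hΛ : -2 / LambdaMin ι M L00 μ (φ (μ, c)) < Δt)
    {S : Set (State E)} (hS : S ∈ 𝓝 (φ (μ, c))) :
    ∃ ε > 0, ∀ δ > 0, ∃ u₀ : State E, ‖u₀ - φ (μ, c)‖ < δ ∧
      ∃ n, (∀ m < n, iter ι M L00 (power ι (φ (μ, c))) Δt u₀ m ∈ S) ∧
        ε ≤ ‖iter ι M L00 (power ι (φ (μ, c))) Δt u₀ n - φ (μ, c)‖ := by
  have hu : CoeffDefined ι M (φ (μ, c)) := coeffDefined_of_ne_zero hι hMpos h.ne_zero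
  have hP := power_ne_zero hι h.ne_zero
  rw [LambdaMin, LPCV_eq] at hΛ
  obtain ⟨p, a, b, ρ, hp, hρ, hT, hgrow⟩ :=
    (isLinearizedStep_stepDeriv hMsymm hMpos hu hP h.L0_eq_zero Δt).exists_growth
      (h.compression_ne_zero hX hu) hΛ
  exact exists_iterate_far (hasQuadraticExpansionAt_step hu hP h.contDiffAt h.L0_eq_zero Δt)
    (step_eq_self hu hP h.L0_eq_zero Δt) hp hρ hT hgrow hS

end IsNondegenerateWave

end

end PCSOM

theorem theorem4 {N K s : ℕ} (hN : 0 < N) (hK : 0 < K)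
    -- the energy spaces, embedded continuously and densely in `L²(ℝ^N)`
    {E : Fin K → Type*} [∀ k, NormedAddCommGroup (E k)] [∀ k, NormedSpace ℝ (E k)]
    [∀ k, CompleteSpace (E k)]
    (ι : ∀ k, E k →L[ℝ] L2 N) (hι : ∀ k, Function.Injective (ι k))
    (hιd : ∀ k, DenseRange (ι k))
    -- the Hermitian and positive definite acceleration operator `M = diag(M_1, …, M_K)`
    (M : ∀ k, E k ≃L[ℝ] StrongDual ℝ (E k)) (hMsymm : ∀ k a b, M k a b = M k b a)
    (hMpos : ∀ k a, a ≠ 0 → 0 < M k a a)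
    -- the family `φ (μ, c)` of solitary waves, with independent propagation constants `μ` and
    -- with the free parameters `c` of the general solution
    (L00 : State E → CoState E) (φ : (Fin K → ℝ) × (Fin s → ℝ) → State E)
    (U : Set ((Fin K → ℝ) × (Fin s → ℝ))) (hU : IsOpen U) (hφ : ContDiffOn ℝ 1 φ U)
    (hsol : ∀ p ∈ U, L0 ι L00 p.1 (φ p) = 0)
    -- the solitary wave `u = φ (μ, c)` under consideration
    (μ : Fin K → ℝ) (c : Fin s → ℝ) (hμc : (μ, c) ∈ U)
    (hL00 : ContDiffAt ℝ 2 L00 (φ (μ, c)))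
    -- the kernel of `L₁` consists of the invariance modes, and the range of `L₁` is closed
    (hker : LinearMap.ker (L1 ι L00 μ (φ (μ, c))).toLinearMap =
      Submodule.span ℝ (Set.range (mode φ μ c)))
    (hran : IsClosed (Set.range (L1 ι L00 μ (φ (μ, c)))))
    -- the solitary waves are orthogonal to the kernel of `L₁`, component by component
    (horth : ∀ d, (μ, d) ∈ U → ∀ ψ, L1 ι L00 μ (φ (μ, d)) ψ = 0 →
      ∀ k, ip ι k (φ (μ, d) k) (ψ k) = 0)
    (hD : (powerJacobian ι φ μ c).det ≠ 0)
    (Δt : ℝ) (hΔt : 0 < Δt) :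
    -- convergence
    (Δt < -2 / LambdaMin ι M L00 μ (φ (μ, c)) →
      ∀ ε > 0, ∃ δ > 0, ∀ u₀ : State E, ‖u₀ - φ (μ, c)‖ < δ →
        (∀ n, StepDefined ι M L00 Δt (iter ι M L00 (power ι (φ (μ, c))) Δt u₀ n)) ∧
        (∀ n, ‖iter ι M L00 (power ι (φ (μ, c))) Δt u₀ n - φ (μ, c)‖ < ε) ∧
        ∃ d, ‖d - c‖ < ε ∧ (μ, d) ∈ U ∧ power ι (φ (μ, d)) = power ι (φ (μ, c)) ∧
          Tendsto (iter ι M L00 (power ι (φ (μ, c))) Δt u₀) atTop (𝓝 (φ (μ, d)))) ∧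
    -- divergence
    (-2 / LambdaMin ι M L00 μ (φ (μ, c)) < Δt →
      ∃ ε > 0, ∀ δ > 0, ∃ u₀ : State E, ‖u₀ - φ (μ, c)‖ < δ ∧
        ∃ n, (∀ m < n, StepDefined ι M L00 Δt (iter ι M L00 (power ι (φ (μ, c))) Δt u₀ m)) ∧
          ε ≤ ‖iter ι M L00 (power ι (φ (μ, c))) Δt u₀ n - φ (μ, c)‖) := by
  have h : IsNondegenerateWave ι L00 φ U μ c := ⟨⟨hU, hφ, hsol⟩, hμc, hL00, hker, hran, horth, hD⟩
  have hX := not_finiteDimensional_state hN hK hιd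
  have hdef : ∀ᶠ v in 𝓝 (φ (μ, c)), StepDefined ι M L00 Δt v :=
    eventually_stepDefined h.ne_zero (coeffDefined_of_ne_zero hι hMpos h.ne_zero) hL00
      h.L0_eq_zero Δt
  refine ⟨fun hΛ ε hε => ?_, fun hΛ => h.exists_iter_far hX hι hMsymm hMpos hΛ hdef⟩
  have hpow : ∀ᶠ d in 𝓝 c, (μ, d) ∈ U ∧ power ι (φ (μ, d)) = power ι (φ (μ, c)) :=
    (h.isWaveFamily.eventually_mem_right hμc).and
      (h.isWaveFamily.eventually_power_eq hμc hL00 horth)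
  obtain ⟨δ, hδ, hconv⟩ := Metric.eventually_nhds_iff.1 <|
    h.eventually_iter_tendsto hX hι hMsymm hMpos hΔt hΛ
      (hdef.and (Metric.ball_mem_nhds _ hε)) (hpow.and (Metric.ball_mem_nhds c hε))
  refine ⟨δ, hδ, fun u₀ hu₀ => ?_⟩
  obtain ⟨hiter, d, ⟨⟨hdU, hdP⟩, hdε⟩, hlim⟩ := hconv ((dist_eq_norm u₀ _).trans_lt hu₀)
  exact ⟨fun n => (hiter n).1, fun n => mem_ball_iff_norm.1 (hiter n).2, d,
    mem_ball_iff_norm.1 hdε, hdU, hdP, hlim⟩
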